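/- Call a group $G$ \emph{$\omega$-existentially saturated} if it realizes every existential type over a finite parameter set, that is: for every finite $A\subseteq G$, every $n\in\mathbb N$ and every set $p(x_1,\dots,x_n)$ of existential first-order formulas in the language of groups with parameters from $A$, if some tuple in some group $K\supseteq G$ satisfies all formulas of $p$ in $K$, then some tuple in $G$ satisfies all formulas of $p$ in $G$. For a group $G$, let $\ell^2(G)$ be the Hilbert space with orthonormal basis $(\delta_h)_{h\in G}$, let $u_g$ be the unitary with $u_g\delta_h=\delta_{gh}$, and let the group von Neumann algebra $L(G)$ be the closure of $\operatorname{span}\{u_g : g\in G\}$ in $\mathcal B(\ell^2(G))$ in the strong operator topology, with the trace $\operatorname{tr}(x)=\langle x\delta_e,\delta_e\rangle$ and the norm $\|x\|_2=\sqrt{\operatorname{tr}(x^*x)}$. Regard $(L(G),\operatorname{tr})$ as a many-sorted metric structure whose sorts are the closed operator norm balls of integer radius, with the metric of $\|\cdot\|_2$, the constants $0,1$ in the unit ball, the inclusions between the balls, the restrictions to the balls of addition, multiplication, scalar multiplication and adjoint, and the real and imaginary parts of the trace. \textbf{Corollary.} If $G$ and $H$ are $\omega$-existentially saturated groups, then $L(G)$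 and $L(H)$ are elementarily equivalent: every sentence of continuous first-order logic in this language has the same value in $L(G)$ and in $L(H)$. -/

import Mathlib

universe u v

/-! ### Existentially saturated groups -/

/-- The function symbols of the first-order language of groups. -/
inductive GroupFunc : ℕ → Type
  | one : GroupFunc 0
  | inv : GroupFunc 1
  | mul : GroupFunc 2

/-- The first-order language of groups `(1, ⁻¹, *)`. -/
def groupLanguage : FirstOrder.Language where
  Functions := GroupFunc
  Relations := fun _ => Empty

/-- Every group is a structure in the language of groups. -/
instance groupLanguageStructure (G : Type u) [Group G] : groupLanguage.Structure G where
  funMap := fun {n} (f : GroupFunc n) =>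
    match n, f with
    | _, .one => fun _ => 1
    | _, .inv => fun x => (x 0)⁻¹
    | _, .mul => fun x => x 0 * x 1
  RelMap := fun r => nomatch r

/-- An existential `n`-type over the finite set `A` of parameters of the group `G` (relative to the
theory of groups): a set of existential formulas in `n` variables with parameters from `A`, all of
which are satisfied together by some tuple in some group that extends `G`. -/
def IsExistentialType {G : Type u} [Group G] (A : Finset G) {n : ℕ}
    (p : Set (groupLanguage.Formula (A ⊕ Fin n))) : Prop :=
  (∀ φ ∈ p, FirstOrder.Language.BoundedFormula.IsExistential φ) ∧
    ∃ (K : Type u) (_ : Group K) (f : G →* K), Function.Injective f ∧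
      ∃ y : Fin n → K, ∀ φ ∈ p, φ.Realize (Sum.elim (fun a : A => f a) y)

/-- A group `G` is `ω`-existentially saturated if it realizes every existential type over a finite
set of parameters. -/
def IsOmegaExistentiallySaturated (G : Type u) [Group G] : Prop :=
  ∀ (A : Finset G) (n : ℕ) (p : Set (groupLanguage.Formula (A ⊕ Fin n))),
    IsExistentialType A p →
      ∃ y : Fin n → G, ∀ φ ∈ p, φ.Realize (Sum.elim (fun a : A => (a : G)) y)

/-! ### The strong operator closure of a `*`-algebra of operators -/

/-- The closure of a set of bounded operators in the strong operator topology, that is, in the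
topology of pointwise convergence. -/
noncomputable def sotClosure {E : Type*} [NormedAddCommGroup E] [InnerProductSpace ℂ E]
    (S : Set (E →L[ℂ] E)) : Set (E →L[ℂ] E) :=
  {T | ContinuousLinearMap.toPointwiseConvergenceCLM ℂ (RingHom.id ℂ) E E T ∈
    closure (ContinuousLinearMap.toPointwiseConvergenceCLM ℂ (RingHom.id ℂ) E E '' S)}

theorem mem_sotClosure_iff {E : Type*} [NormedAddCommGroup E] [InnerProductSpace ℂ E]
    {S : Set (E →L[ℂ] E)} {T : E →L[ℂ] E} :
    T ∈ sotClosure S ↔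
      ∀ (s : Finset E) (ε : ℝ), 0 < ε → ∃ a ∈ S, ∀ ξ ∈ s, ‖a ξ - T ξ‖ < ε := by
  have key : T ∈ sotClosure S ↔ (T : E → E) ∈ closure ((fun a : E →L[ℂ] E => (a : E → E)) '' S) := by
    unfold sotClosure
    rw [(PointwiseConvergenceCLM.isEmbedding_coeFn (RingHom.id ℂ) E E).closure_eq_preimage_closure_image,
      Set.image_image]
    rfl
  have hb : (nhds (T : E → E)).HasBasis
      (fun p : Set E × (E → ℝ) => p.1.Finite ∧ ∀ ξ ∈ p.1, 0 < p.2 ξ)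
      (fun p => p.1.pi fun ξ => Metric.ball (T ξ) (p.2 ξ)) := by
    rw [nhds_pi]
    exact Filter.hasBasis_pi fun ξ => Metric.nhds_basis_ball
  rw [key, mem_closure_iff_nhds_basis hb]
  constructor
  · intro h s ε hε
    obtain ⟨_, ⟨a, ha, rfl⟩, h2⟩ := h ⟨s, fun _ => ε⟩ ⟨s.finite_toSet, fun _ _ => hε⟩
    exact ⟨a, ha, fun ξ hξ => by simpa [dist_eq_norm] using h2 ξ hξ⟩
  · rintro h ⟨s, r⟩ ⟨hs, hr⟩
    simp only at hs hr
    obtain ⟨ε, hε, hεr⟩ : ∃ ε : ℝ, 0 < ε ∧ ∀ ξ ∈ s, ε ≤ r ξ := by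
      rcases s.eq_empty_or_nonempty with rfl | hne
      · exact ⟨1, one_pos, by simp⟩
      · obtain ⟨ξ₀, h₀, hm⟩ := hs.exists_minimalFor r s hne
        refine ⟨r ξ₀, hr _ h₀, fun ξ hξ => ?_⟩
        rcases le_total (r ξ₀) (r ξ) with h1 | h1
        · exact h1
        · exact hm hξ h1
    obtain ⟨a, ha, h2⟩ := h hs.toFinset ε hε
    refine ⟨_, ⟨a, ha, rfl⟩, fun ξ hξ => ?_⟩
    have := h2 ξ (by simpa using hξ)
    simpa [dist_eq_norm] using this.trans_le (hεr ξ hξ)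

/-- The bicommutant theorem. -/
theorem sotClosure_eq_bicommutant {E : Type*} [NormedAddCommGroup E] [InnerProductSpace ℂ E]
    [CompleteSpace E] (S : StarSubalgebra ℂ (E →L[ℂ] E)) :
    sotClosure (S : Set (E →L[ℂ] E)) = Set.centralizer (Set.centralizer (S : Set (E →L[ℂ] E))) := by
  classical
  ext T
  constructor
  · intro hT
    rw [Set.mem_centralizer_iff]
    intro c hc
    rw [Set.mem_centralizer_iff] at hc
    rw [mem_sotClosure_iff] at hT
    ext ξ
    refine eq_of_forall_dist_le fun ε hε => ?_
    have hC : 0 < ‖c‖ + 1 := by positivity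
    obtain ⟨a, ha, h⟩ := hT {ξ, c ξ} (ε / (‖c‖ + 1)) (by positivity)
    have h1 := h ξ (by simp)
    have h2 := h (c ξ) (by simp)
    have h3 : c (a ξ) = a (c ξ) := by
      simpa using congrArg (fun f : E →L[ℂ] E => f ξ) (hc a ha).symm
    have h4 : ‖c (a ξ - T ξ)‖ ≤ ‖c‖ * (ε / (‖c‖ + 1)) :=
      (c.le_opNorm _).trans (by gcongr)
    have h5 : (c * T) ξ - (T * c) ξ = (a (c ξ) - T (c ξ)) - c (a ξ - T ξ) := by
      simp [h3]
    rw [dist_eq_norm, h5]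
    calc _ ≤ ε / (‖c‖ + 1) + ‖c‖ * (ε / (‖c‖ + 1)) :=
          (norm_sub_le _ _).trans (add_le_add h2.le h4)
      _ = ε := by field_simp; ring
  · intro hT
    rw [mem_sotClosure_iff]
    intro s ε hε
    let e := PiLp.continuousLinearEquiv 2 ℂ (fun _ : s => E)
    let amp : (E →L[ℂ] E) → (PiLp 2 (fun _ : s => E) →L[ℂ] PiLp 2 (fun _ : s => E)) := fun a =>
      (e.symm : (s → E) →L[ℂ] PiLp 2 (fun _ : s => E)) ∘L (ContinuousLinearMap.piMap fun _ : s => a) ∘L (e : PiLp 2 (fun _ : s => E) →L[ℂ] (s → E))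
    let V : s → E →L[ℂ] PiLp 2 (fun _ : s => E) := fun j =>
      (e.symm : (s → E) →L[ℂ] PiLp 2 (fun _ : s => E)) ∘L ContinuousLinearMap.single ℂ (fun _ : s => E) j
    let pr : s → PiLp 2 (fun _ : s => E) →L[ℂ] E := fun i => PiLp.proj 2 (fun _ : s => E) i
    have amp_apply : ∀ a x i, (amp a x) i = a (x i) := fun a x i => rfl
    have V_amp : ∀ a j x, V j (a x) = amp a (V j x) := by
      intro a j x
      ext i
      rw [amp_apply]
      change (Pi.single j (a x) : s → E) i = a ((Pi.single j x : s → E) i)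
      by_cases hij : i = j
      · subst hij; simp
      · simp [hij]
    have V_sum : ∀ x, ∑ j, V j (x j) = x := by
      intro x
      apply e.injective
      rw [map_sum]
      have : ∀ j, e (V j (x j)) = Pi.single j (x j) := fun j => rfl
      simp only [this]
      exact Finset.univ_sum_single (e x)
    let ξ : PiLp 2 (fun _ : s => E) := e.symm fun i => (i : E)
    let orb : (E →L[ℂ] E) →ₗ[ℂ] PiLp 2 (fun _ : s => E) :=
      { toFun := fun a => amp a ξ
        map_add' := fun a b => by ext i; simp [amp_apply]
        map_smul' := fun c a => by ext i; simp [amp_apply] }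
    let K₀ : Submodule ℂ (PiLp 2 (fun _ : s => E)) := S.toSubalgebra.toSubmodule.map orb
    let K := K₀.topologicalClosure
    have hKc : IsClosed (K : Set (PiLp 2 (fun _ : s => E))) := K₀.isClosed_topologicalClosure
    have : CompleteSpace K := hKc.completeSpace_coe
    have hinv : ∀ a ∈ S, ∀ x ∈ K, amp a x ∈ K := by
      intro a ha x hx
      refine map_mem_closure (amp a).continuous hx ?_
      rintro _ ⟨b, hb, rfl⟩
      exact ⟨a * b, S.mul_mem ha hb, rfl⟩
    have hadj : ∀ a x y, inner ℂ (amp (star a) x) y = inner ℂ x (amp a y) := by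
      intro a x y
      simp only [PiLp.inner_apply, amp_apply]
      exact Finset.sum_congr rfl fun i _ => ContinuousLinearMap.adjoint_inner_left a _ _
    have hcomm : ∀ a ∈ S, ∀ x, K.starProjection (amp a x) = amp a (K.starProjection x) := by
      intro a ha x
      refine Submodule.eq_starProjection_of_mem_orthogonal
        (hinv a ha _ (K.starProjection_apply_mem x)) ?_
      rw [← map_sub, Submodule.mem_orthogonal]
      intro u hu
      rw [← hadj]
      exact (Submodule.mem_orthogonal _ _).1 (K.sub_starProjection_mem_orthogonal x) _
        (hinv _ (S.star_mem' ha) u hu)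
    have hent : ∀ i j, pr i ∘L K.starProjection ∘L V j ∈
        Set.centralizer (S : Set (E →L[ℂ] E)) := by
      intro i j
      rw [Set.mem_centralizer_iff]
      intro a ha
      ext x
      change a ((K.starProjection (V j x)) i) = (K.starProjection (V j (a x))) i
      rw [V_amp, hcomm a ha, amp_apply]
    have hTcomm : K.starProjection (amp T ξ) = amp T (K.starProjection ξ) := by
      ext i
      rw [amp_apply]
      conv_lhs => rw [← V_sum ξ]
      conv_rhs => rw [← V_sum ξ]
      simp only [map_sum, WithLp.ofLp_sum, Finset.sum_apply]
      refine Finset.sum_congr rfl fun j _ => ?_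
      rw [← V_amp]
      have := (Set.mem_centralizer_iff.1 hT) _ (hent i j)
      exact congrArg (fun f : E →L[ℂ] E => f (ξ j)) this
    have hξ : ξ ∈ K := K₀.le_topologicalClosure ⟨1, S.one_mem, rfl⟩
    have hTξ : amp T ξ ∈ K := by
      rw [← Submodule.starProjection_eq_self_iff, hTcomm,
        Submodule.starProjection_eq_self_iff.2 hξ]
    obtain ⟨_, ⟨a, ha, rfl⟩, hd⟩ := Metric.mem_closure_iff.1 hTξ ε hε
    refine ⟨a, ha, fun η hη => ?_⟩
    have h1 : ‖(amp T ξ - amp a ξ) ⟨η, hη⟩‖ ≤ ‖amp T ξ - amp a ξ‖ := PiLp.norm_apply_le _ _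
    rw [dist_eq_norm] at hd
    rw [norm_sub_rev]
    exact h1.trans_lt hd

/-- The von Neumann algebra generated by a unital `*`-algebra `S` of operators: its closure in the
strong operator topology. -/
noncomputable def sotClosureVNA {E : Type*} [NormedAddCommGroup E] [InnerProductSpace ℂ E]
    [CompleteSpace E] (S : StarSubalgebra ℂ (E →L[ℂ] E)) : VonNeumannAlgebra E where
  carrier := sotClosure (S : Set (E →L[ℂ] E))
  mul_mem' := by
    rw [sotClosure_eq_bicommutant]
    exact fun ha hb => Set.mul_mem_centralizer ha hb
  one_mem' := by
    rw [sotClosure_eq_bicommutant]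
    exact Set.one_mem_centralizer
  add_mem' := by
    rw [sotClosure_eq_bicommutant]
    exact fun ha hb => Set.add_mem_centralizer ha hb
  zero_mem' := by
    rw [sotClosure_eq_bicommutant]
    exact Set.zero_mem_centralizer
  algebraMap_mem' := fun r => by
    rw [sotClosure_eq_bicommutant]
    exact fun a _ => (Algebra.commutes r a).symm
  star_mem' := by
    rw [sotClosure_eq_bicommutant]
    intro a ha
    rw [Set.mem_centralizer_iff] at ha ⊢
    intro c hc
    have hc' : star c ∈ Set.centralizer (S : Set (E →L[ℂ] E)) := by
      rw [Set.mem_centralizer_iff] at hc ⊢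
      intro s hs
      have := congrArg star (hc (star s) (star_mem hs))
      simpa using this.symm
    have := congrArg star (ha (star c) hc')
    simpa using this.symm
  centralizer_centralizer' := by
    rw [sotClosure_eq_bicommutant, Set.centralizer_centralizer_centralizer]

/-! ### The group von Neumann algebra and its trace -/

/-- The Hilbert space `ℓ²(G)`. -/
abbrev GroupL2 (G : Type u) : Type u := lp (fun _ : G => ℂ) 2

/-- The unitary `u_g` on `ℓ²(G)`, as a linear isometry: `(u_g ξ)(h) = ξ(g⁻¹ h)`. -/
noncomputable def leftTranslation {G : Type u} [Group G] (g : G) : GroupL2 G →ₗᵢ[ℂ] GroupL2 G where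
  toFun ξ := ⟨fun h => ξ (g⁻¹ * h), by
    refine memℓp_gen ?_
    exact ((Equiv.mulLeft g⁻¹).summable_iff).2 ((lp.memℓp ξ).summable (by norm_num))⟩
  map_add' ξ η := by ext h; rfl
  map_smul' c ξ := by ext h; rfl
  norm_map' ξ := by
    refine (Real.rpow_left_inj (norm_nonneg _) (norm_nonneg _)
      (z := (2 : ENNReal).toReal) (by norm_num)).1 ?_
    rw [lp.norm_rpow_eq_tsum (by norm_num), lp.norm_rpow_eq_tsum (by norm_num)]
    exact (Equiv.mulLeft g⁻¹).tsum_eq (fun h => ‖ξ h‖ ^ (2 : ENNReal).toReal)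

/-- The basis vector `δ_g` of `ℓ²(G)`. -/
noncomputable def deltaVec {G : Type u} (g : G) : GroupL2 G :=
  letI := Classical.decEq G
  lp.single 2 g (1 : ℂ)

/-- The translations act on the basis by `u_g δ_h = δ_{gh}`. -/
theorem leftTranslation_deltaVec {G : Type u} [Group G] (g h : G) :
    leftTranslation g (deltaVec h) = deltaVec (g * h) := by
  classical
  ext k
  change (deltaVec h : G → ℂ) (g⁻¹ * k) = (deltaVec (g * h) : G → ℂ) k
  simp only [deltaVec, lp.coeFn_single, Pi.single_apply]
  congr 1
  exact propext inv_mul_eq_iff_eq_mul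

/-- The left regular representation `g ↦ u_g` of `G` on `ℓ²(G)`. -/
noncomputable def leftRegular (G : Type u) [Group G] : G →* (GroupL2 G →L[ℂ] GroupL2 G) where
  toFun g := (leftTranslation g).toContinuousLinearMap
  map_one' := by
    ext ξ h
    change ξ (1⁻¹ * h) = ξ h
    simp
  map_mul' g g' := by
    ext ξ h
    change ξ ((g * g')⁻¹ * h) = ξ (g'⁻¹ * (g⁻¹ * h))
    simp [mul_assoc]

theorem star_leftRegular {G : Type u} [Group G] (g : G) :
    star (leftRegular G g) = leftRegular G g⁻¹ := by
  rw [ContinuousLinearMap.star_eq_adjoint]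
  refine Eq.symm ((ContinuousLinearMap.eq_adjoint_iff _ _).2 fun ξ η => ?_)
  have h : leftTranslation g (leftRegular G g⁻¹ ξ) = ξ := by
    ext h
    change ξ (g⁻¹⁻¹ * (g⁻¹ * h)) = ξ h
    simp
  conv_rhs => rw [← h]
  exact ((leftTranslation g).inner_map_map _ η).symm

/-- The image of the group algebra `ℂ[G]` in the bounded operators on `ℓ²(G)` under the linear
extension of the left regular representation. -/
noncomputable def groupAlgebraImage (G : Type u) [Group G] :
    StarSubalgebra ℂ (GroupL2 G →L[ℂ] GroupL2 G) where
  toSubalgebra := (MonoidAlgebra.lift ℂ (GroupL2 G →L[ℂ] GroupL2 G) G (leftRegular G)).range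
  star_mem' := by
    rintro _ ⟨x, rfl⟩
    change star (MonoidAlgebra.lift ℂ (GroupL2 G →L[ℂ] GroupL2 G) G (leftRegular G) x) ∈
      (MonoidAlgebra.lift ℂ (GroupL2 G →L[ℂ] GroupL2 G) G (leftRegular G)).range
    induction x using MonoidAlgebra.induction_on with
    | of g =>
      refine ⟨MonoidAlgebra.of ℂ G g⁻¹, ?_⟩
      simp [star_leftRegular]
    | add x y hx hy =>
      rw [map_add, star_add]
      exact add_mem hx hy
    | smul c x hx =>
      rw [map_smul, star_smul]
      exact Subalgebra.smul_mem _ hx _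

/-- The group von Neumann algebra `L(G)`: the closure of `ℂ[G]` in the strong operator topology of
the bounded operators on `ℓ²(G)`. -/
noncomputable def groupVNA (G : Type u) [Group G] : VonNeumannAlgebra (GroupL2 G) :=
  sotClosureVNA (groupAlgebraImage G)

/-- The canonical trace `tr(x) = ⟨x δ_e, δ_e⟩` (the inner product of Mathlib is linear in its second
argument). -/
noncomputable def groupTrace (G : Type u) [Group G] (x : GroupL2 G →L[ℂ] GroupL2 G) : ℂ :=
  inner ℂ (deltaVec (1 : G)) (x (deltaVec 1))

/-! ### Continuous logic for tracial von Neumann algebras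

The language is many-sorted: the sort `n : ℕ` stands for the closed operator norm ball of radius
`n`, with the metric of the trace norm `‖x‖₂ = √tr(x* x)`. A context is the list of the sorts of
the variables that may occur free. -/

namespace TracialLogic

/-- Variables of sort `n` in a context. -/
inductive Var : List ℕ → ℕ → Type
  | here {Γ : List ℕ} {n : ℕ} : Var (n :: Γ) n
  | there {Γ : List ℕ} {m n : ℕ} (x : Var Γ n) : Var (m :: Γ) n

/-- Terms of sort `n` in a context: variables, the constants `0` and `1` of the unit ball, the
inclusions between the balls, and the algebraic operations restricted to the balls. -/
inductive Term (Γ : List ℕ) : ℕ → Type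
  | var {n : ℕ} (x : Var Γ n) : Term Γ n
  | zero : Term Γ 1
  | one : Term Γ 1
  | incl {m n : ℕ} (h : m ≤ n) (t : Term Γ m) : Term Γ n
  | add {m n : ℕ} (s : Term Γ m) (t : Term Γ n) : Term Γ (m + n)
  | mul {m n : ℕ} (s : Term Γ m) (t : Term Γ n) : Term Γ (m * n)
  | smul {n : ℕ} (c : ℂ) (t : Term Γ n) : Term Γ (⌈‖c‖⌉₊ * n)
  | adj {n : ℕ} (t : Term Γ n) : Term Γ n

/-- Formulas of continuous logic in a context. The atomic formulas are the distance of two terms of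
the same sort and the real and imaginary part of the trace of a term; the connectives are the
continuous functions `ℝᵏ → ℝ`; the quantifiers are the supremum and the infimum over a sort. -/
inductive Formula : List ℕ → Type
  | dist {Γ : List ℕ} {n : ℕ} (s t : Term Γ n) : Formula Γ
  | reTr {Γ : List ℕ} {n : ℕ} (t : Term Γ n) : Formula Γ
  | imTr {Γ : List ℕ} {n : ℕ} (t : Term Γ n) : Formula Γ
  | conn {Γ : List ℕ} {k : ℕ} (f : C(Fin k → ℝ, ℝ)) (φ : Fin k → Formula Γ) : Formula Γ
  | sup {Γ : List ℕ} (n : ℕ) (φ : Formula (n :: Γ)) : Formula Γ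
  | inf {Γ : List ℕ} (n : ℕ) (φ : Formula (n :: Γ)) : Formula Γ

/-- A sentence is a formula without free variables. -/
abbrev Sentence : Type := Formula []

section Semantics

variable {E : Type*} [NormedAddCommGroup E] [InnerProductSpace ℂ E] [CompleteSpace E]

/-- The sort `n` of the von Neumann algebra `M`: its closed operator norm ball of radius `n`. -/
def Ball (M : VonNeumannAlgebra E) (n : ℕ) : Type _ :=
  {x : E →L[ℂ] E // x ∈ M ∧ ‖x‖ ≤ n}

/-- An assignment of elements of `M` to the variables of a context. -/
def Assignment (M : VonNeumannAlgebra E) (Γ : List ℕ) : Type _ :=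
  ∀ n : ℕ, Var Γ n → Ball M n

/-- The assignment to the variables of the empty context. -/
def Assignment.nil (M : VonNeumannAlgebra E) : Assignment M [] :=
  fun _ x => nomatch x

/-- Extend an assignment by a value for one new variable. -/
def Assignment.cons {M : VonNeumannAlgebra E} {Γ : List ℕ} {m : ℕ} (a : Ball M m)
    (v : Assignment M Γ) : Assignment M (m :: Γ) :=
  fun _ x =>
    match x with
    | .here => a
    | .there y => v _ y

/-- The value of a term. -/
noncomputable def Term.eval {M : VonNeumannAlgebra E} {Γ : List ℕ} (v : Assignment M Γ) :
    {n : ℕ} → Term Γ n → Ball M n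
  | _, .var x => v _ x
  | _, .zero => ⟨0, zero_mem M, by simp⟩
  | _, .one => ⟨1, one_mem M, by
      rw [Nat.cast_one]
      exact ContinuousLinearMap.norm_id_le⟩
  | _, .incl h t => ⟨(t.eval v).1, (t.eval v).2.1, (t.eval v).2.2.trans (by exact_mod_cast h)⟩
  | _, .add s t => ⟨(s.eval v).1 + (t.eval v).1, add_mem (s.eval v).2.1 (t.eval v).2.1, by
      push_cast
      exact (norm_add_le _ _).trans (add_le_add (s.eval v).2.2 (t.eval v).2.2)⟩
  | _, .mul s t => ⟨(s.eval v).1 * (t.eval v).1, mul_mem (s.eval v).2.1 (t.eval v).2.1, by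
      push_cast
      exact (norm_mul_le _ _).trans
        (mul_le_mul (s.eval v).2.2 (t.eval v).2.2 (norm_nonneg _) (Nat.cast_nonneg _))⟩
  | _, .smul c t => ⟨c • (t.eval v).1, M.toStarSubalgebra.smul_mem (t.eval v).2.1 c, by
      push_cast
      rw [norm_smul]
      exact mul_le_mul (Nat.le_ceil _) (t.eval v).2.2 (norm_nonneg _) (Nat.cast_nonneg _)⟩
  | _, .adj t => ⟨star (t.eval v).1, star_mem (t.eval v).2.1, by
      rw [norm_star]
      exact (t.eval v).2.2⟩

/-- The norm `‖x‖₂ = √τ(x* x)` of a trace `τ`. -/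
noncomputable def traceNorm (τ : (E →L[ℂ] E) → ℂ) (x : E →L[ℂ] E) : ℝ :=
  √(τ (star x * x)).re

/-- The value of a formula in the von Neumann algebra `M` with the trace `τ`. -/
noncomputable def Formula.eval (M : VonNeumannAlgebra E) (τ : (E →L[ℂ] E) → ℂ) :
    {Γ : List ℕ} → Formula Γ → Assignment M Γ → ℝ
  | _, .dist s t, v => traceNorm τ ((s.eval v).1 - (t.eval v).1)
  | _, .reTr t, v => (τ (t.eval v).1).re
  | _, .imTr t, v => (τ (t.eval v).1).im
  | _, .conn f φ, v => f fun i => (φ i).eval M τ v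
  | _, .sup n φ, v => ⨆ a : Ball M n, φ.eval M τ (Assignment.cons a v)
  | _, .inf n φ, v => ⨅ a : Ball M n, φ.eval M τ (Assignment.cons a v)

/-- The tracial von Neumann algebras `(M, τ)` and `(N, τ')` are elementarily equivalent: every
sentence of continuous logic has the same value in both. -/
def ElementarilyEquivalent {E' : Type*} [NormedAddCommGroup E'] [InnerProductSpace ℂ E']
    [CompleteSpace E'] (M : VonNeumannAlgebra E) (τ : (E →L[ℂ] E) → ℂ)
    (N : VonNeumannAlgebra E') (τ' : (E' →L[ℂ] E') → ℂ) : Prop :=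
  ∀ σ : Sentence, σ.eval M τ (Assignment.nil M) = σ.eval N τ' (Assignment.nil N)

end Semantics

end TracialLogic

/-! Between two saturated groups there is a back-and-forth system consisting of pairs of embeddings
`P → G`, `P → H` of one finitely generated group. To enlarge `P` to `P'`, amalgamate `P'` with `H`
over `P`: the pushout extends `H`, and the quantifier-free type of generators of `P'` over the
images of generators of `P` is existential, hence realized in `H`
(`IsOmegaExistentiallySaturated.exists_extend`, `back_and_forth`).

Such a pair matches the images of each element of `ℂ[P]` in `L(G)` and `L(H)`. The trace only sees
the coefficient at the identity, so matched operators have equal traces and equal `2`-norms. They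
also have equal operator norms, because the vectors `c δ_e` on which a norm is tested can themselves
be matched (`norm_le_of_pairRel`). Thus matching respects the sorts.

General elements of a ball are reached by approximation. By Kaplansky density
(`exists_groupAlgebraImage_near`) the group algebra elements of norm at most `n` are `2`-norm dense
in the ball of radius `n`, and every formula is bounded and uniformly continuous in the `2`-norm
(`Formula.bounded_and_uniformContinuous`). Induction on formulas then gives equal values at matched
assignments (`Formula.transfers`). -/

/-! ### Embedding finitely generated groups into saturated groups -/

open FirstOrder in
/-- Quantifier-free types of tuples in extensions of a saturated group are realized. -/
theorem IsOmegaExistentiallySaturated.exists_realize_eq_iff {H : Type v} [Group H]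
    (hH : IsOmegaExistentiallySaturated H) {K : Type v} [Group K] (j : H →* K)
    (hj : Function.Injective j) (A : Finset H) {n : ℕ} (y : Fin n → K) :
    ∃ z : Fin n → H, ∀ s t : groupLanguage.Term (A ⊕ Fin n),
      s.realize (Sum.elim (fun a : A => (a : H)) z) =
          t.realize (Sum.elim (fun a : A => (a : H)) z) ↔
        s.realize (Sum.elim (fun a : A => j a) y) = t.realize (Sum.elim (fun a : A => j a) y) := by
  -- The type contains inequations as well as equations: equations transfer truth from `K` to `H`,
  -- inequations transfer it back.
  let p : Set (groupLanguage.Formula (A ⊕ Fin n)) :=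
    {φ | Language.BoundedFormula.IsQF φ ∧ φ.Realize (Sum.elim (fun a : A => j a) y)}
  obtain ⟨z, hz⟩ := hH A n p ⟨fun φ hφ => hφ.1.isExistential, K, inferInstance, j, hj, y,
    fun φ hφ => hφ.2⟩
  refine ⟨z, fun s t => ?_⟩
  have hqf : Language.BoundedFormula.IsQF (Language.Term.equal s t) :=
    (Language.BoundedFormula.IsAtomic.equal _ _).isQF
  constructor
  · intro h
    by_contra hne
    have := hz (Language.Formula.not (Language.Term.equal s t))
      ⟨hqf.not, by rwa [Language.Formula.realize_not, Language.Formula.realize_equal]⟩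
    rw [Language.Formula.realize_not, Language.Formula.realize_equal] at this
    exact this h
  · intro h
    have := hz (Language.Term.equal s t) ⟨hqf, by rwa [Language.Formula.realize_equal]⟩
    rwa [Language.Formula.realize_equal] at this

/-- A finitely generated group that embeds into an extension of a saturated group `H` embeds into
`H`, with prescribed values at the elements of a finite subset of `H`. -/
theorem IsOmegaExistentiallySaturated.exists_embedding_of_extension {H : Type v} [Group H]
    (hH : IsOmegaExistentiallySaturated H) {K : Type v} [Group K] (j : H →* K)
    (hj : Function.Injective j) (A : Finset H) {P : Type*} [Group P] [hP : Group.FG P]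
    (k : P →* K) (hk : Function.Injective k) :
    ∃ F : P →* H, Function.Injective F ∧ ∀ a ∈ A, ∀ p, k p = j a → F p = a := by
  obtain ⟨S, hS⟩ := hP.out
  let e := S.equivFin
  obtain ⟨z, hz⟩ := hH.exists_realize_eq_iff j hj A (fun i => k (e.symm i))
  set valK : A ⊕ Fin S.card → K := Sum.elim (fun a : A => j a) (fun i => k (e.symm i))
  set valH : A ⊕ Fin S.card → H := Sum.elim (fun a : A => (a : H)) z
  let tmul (s t : groupLanguage.Term (A ⊕ Fin S.card)) : groupLanguage.Term (A ⊕ Fin S.card) :=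
    .func (l := 2) GroupFunc.mul ![s, t]
  let tinv (s : groupLanguage.Term (A ⊕ Fin S.card)) : groupLanguage.Term (A ⊕ Fin S.card) :=
    .func (l := 1) GroupFunc.inv ![s]
  let tone : groupLanguage.Term (A ⊕ Fin S.card) := .func (l := 0) GroupFunc.one ![]
  have hterm : ∀ p : P, ∃ t : groupLanguage.Term (A ⊕ Fin S.card), t.realize valK = k p := by
    intro p
    have hp : p ∈ Subgroup.closure (S : Set P) := by rw [hS]; trivial
    induction hp using Subgroup.closure_induction with
    | mem x hx =>
      refine ⟨.var (Sum.inr (e ⟨x, hx⟩)), ?_⟩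
      simp [valK]
    | one => exact ⟨tone, (map_one k).symm⟩
    | mul x y _ _ hx hy =>
      obtain ⟨s, hs⟩ := hx
      obtain ⟨t, ht⟩ := hy
      refine ⟨tmul s t, ?_⟩
      rw [map_mul, ← hs, ← ht]
      rfl
    | inv x _ hx =>
      obtain ⟨s, hs⟩ := hx
      refine ⟨tinv s, ?_⟩
      rw [map_inv, ← hs]
      rfl
  choose t ht using hterm
  -- The choice of the terms is harmless: terms with equal values in `K` have equal values in `H`,
  -- which gives multiplicativity, and the converse gives injectivity.
  let F : P →* H := MonoidHom.mk' (fun p => (t p).realize valH) fun p q => by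
    have : (t (p * q)).realize valH = (tmul (t p) (t q)).realize valH := by
      rw [hz, ht, map_mul, ← ht p, ← ht q]
      rfl
    rw [this]
    rfl
  refine ⟨F, fun p q hpq => hk ?_, fun a ha p hp => ?_⟩
  · rw [← ht p, ← ht q]
    exact (hz _ _).1 hpq
  · have := (hz (t p) (.var (Sum.inl ⟨a, ha⟩))).2 (by rw [ht, hp]; rfl)
    exact this

/-- Extension of embeddings of finitely generated groups into a saturated group. -/
theorem IsOmegaExistentiallySaturated.exists_extend {H : Type v} [Group H]
    (hH : IsOmegaExistentiallySaturated H) {P P' : Type} [Group P] [Group P'] [hP : Group.FG P]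
    [Group.FG P'] (i : P →* P') (hi : Function.Injective i) (f : P →* H)
    (hf : Function.Injective f) :
    ∃ F : P' →* H, Function.Injective F ∧ F.comp i = f := by
  classical
  -- The factors of the amalgam of `H` and `P'` over `P`. The lift puts the pushout in the universe
  -- of `H`, where saturation quantifies over extensions.
  let Q : Bool → Type v := fun b => match b with
    | true => H
    | false => ULift.{v} P'
  let instQ : ∀ b, Group (Q b) := fun b => match b with
    | true => inferInstanceAs (Group H)
    | false => inferInstanceAs (Group (ULift.{v} P'))
  let φ : ∀ b, P →* Q b := fun b => match b with
    | true => f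
    | false => MulEquiv.ulift.symm.toMonoidHom.comp i
  have hφ : ∀ b, Function.Injective (φ b) := fun b => match b with
    | true => hf
    | false => MulEquiv.ulift.symm.injective.comp hi
  let j : H →* Monoid.PushoutI φ := Monoid.PushoutI.of (φ := φ) true
  let k : P' →* Monoid.PushoutI φ :=
    (Monoid.PushoutI.of (φ := φ) false).comp MulEquiv.ulift.symm.toMonoidHom
  have hj : Function.Injective j := Monoid.PushoutI.of_injective hφ true
  have hk : Function.Injective k :=
    (Monoid.PushoutI.of_injective hφ false).comp MulEquiv.ulift.symm.injective
  have hjk : ∀ p, k (i p) = j (f p) := fun p =>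
    (Monoid.PushoutI.of_apply_eq_base φ false p).trans
      (Monoid.PushoutI.of_apply_eq_base φ true p).symm
  -- Fixing the images of finitely many generators of `P` suffices, so a finite parameter set is
  -- enough.
  obtain ⟨S, hS⟩ := hP.out
  obtain ⟨F, hF, hFA⟩ := hH.exists_embedding_of_extension j hj (S.image f) k hk
  refine ⟨F, hF, MonoidHom.eq_of_eqOn_dense hS fun s hs => ?_⟩
  exact hFA _ (Finset.mem_image_of_mem f hs) _ (hjk s)

/-- The back-and-forth property of a saturated group. -/
theorem IsOmegaExistentiallySaturated.back_and_forth {G : Type u} {H : Type v} [Group G] [Group H]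
    (hH : IsOmegaExistentiallySaturated H) {P : Type} [Group P] [hP : Group.FG P]
    (f : P →* G) (hf : Function.Injective f) (f' : P →* H) (hf' : Function.Injective f')
    (S : Finset G) :
    ∃ (P' : Type) (_ : Group P') (_ : Group.FG P') (i : P →* P') (F : P' →* G) (F' : P' →* H),
      Function.Injective F ∧ Function.Injective F' ∧ F.comp i = f ∧ F'.comp i = f' ∧
        ∀ s ∈ S, s ∈ F.range := by
  classical
  obtain ⟨T, hT⟩ := hP.out
  let R : Subgroup G := Subgroup.closure ((T.image f ∪ S : Finset G) : Set G)
  have hR : Group.FG R := (Group.fg_iff_subgroup_fg R).2 ⟨_, rfl⟩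
  have hfR : ∀ p, f p ∈ R := by
    intro p
    have h1 : f.range ≤ R := by
      rw [MonoidHom.range_eq_map, ← hT, MonoidHom.map_closure]
      refine Subgroup.closure_mono ?_
      simp
    exact h1 ⟨p, rfl⟩
  -- A finitely generated group is countable, so it has a copy in `Type`; all groups of the system
  -- can therefore live in one universe, whatever those of `G` and `H`.
  have : Countable R := by
    obtain ⟨T', hT', π, hπ⟩ := Group.fg_iff_exists_freeGroup_hom_surjective.1 hR
    have := hT'.to_subtype
    exact hπ.countable
  let e : Shrink.{0} R ≃* R := Shrink.mulEquiv
  have : Group.FG (Shrink.{0} R) :=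
    Group.fg_of_surjective (f := e.symm.toMonoidHom) e.symm.surjective
  let i : P →* Shrink.{0} R := e.symm.toMonoidHom.comp (f.codRestrict R hfR)
  have hi : Function.Injective i :=
    e.symm.injective.comp fun p q hpq => hf (congrArg Subtype.val hpq)
  obtain ⟨F', hF', hF'i⟩ := hH.exists_extend i hi f' hf'
  refine ⟨Shrink.{0} R, inferInstance, inferInstance, i, R.subtype.comp e.toMonoidHom, F',
    Subtype.val_injective.comp e.injective, hF', ?_, hF'i, fun s hs => ?_⟩
  · ext p
    simp [i]
  · refine ⟨e.symm ⟨s, Subgroup.subset_closure (by simp [hs])⟩, ?_⟩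
    simp

/-! ### The `2`-norm and the density of the group algebra in `ℓ²(G)` -/

/-- Since `⟨x* x δ_e, δ_e⟩ = ‖x δ_e‖²`, all `2`-norm estimates become estimates of vectors. -/
theorem traceNorm_groupTrace {G : Type u} [Group G] (x : GroupL2 G →L[ℂ] GroupL2 G) :
    TracialLogic.traceNorm (groupTrace G) x = ‖x (deltaVec 1)‖ := by
  rw [TracialLogic.traceNorm, groupTrace, mul_apply_eq_comp,
    ContinuousLinearMap.star_eq_adjoint, ContinuousLinearMap.adjoint_inner_right,
    inner_self_eq_norm_sq_to_K]
  norm_cast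
  exact Real.sqrt_sq (norm_nonneg _)

theorem norm_deltaVec {G : Type u} (g : G) : ‖deltaVec g‖ = 1 := by
  classical
  rw [deltaVec, lp.norm_single (by norm_num)]
  simp

theorem inner_deltaVec_left {G : Type u} (g : G) (ξ : GroupL2 G) :
    inner ℂ (deltaVec g) ξ = ξ g := by
  classical
  rw [deltaVec, lp.inner_single_left]
  simp

theorem leftRegular_deltaVec_one {G : Type u} [Group G] (g : G) :
    leftRegular G g (deltaVec 1) = deltaVec g :=
  (leftTranslation_deltaVec g 1).trans (by rw [mul_one])

theorem groupTrace_leftRegular {G : Type u} [Group G] [DecidableEq G] (g : G) :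
    groupTrace G (leftRegular G g) = if g = 1 then 1 else 0 := by
  rw [groupTrace, leftRegular_deltaVec_one, inner_deltaVec_left]
  simp [deltaVec, lp.single_apply, Pi.single_apply, eq_comm]

theorem leftRegular_mem_groupAlgebraImage {G : Type u} [Group G] (g : G) :
    leftRegular G g ∈ groupAlgebraImage G :=
  ⟨MonoidAlgebra.of ℂ G g, by simp⟩

theorem groupAlgebraImage_le_groupVNA {G : Type u} [Group G] {a : GroupL2 G →L[ℂ] GroupL2 G}
    (ha : a ∈ groupAlgebraImage G) : a ∈ groupVNA G :=
  mem_sotClosure_iff.2 fun _ _ hε => ⟨a, ha, fun _ _ => by simpa using hε⟩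

/-- The vectors `c δ_e` with `c` in the group algebra are dense in `ℓ²(G)`. -/
theorem exists_groupAlgebraImage_apply_near {G : Type u} [Group G] (ξ : GroupL2 G) {ε : ℝ}
    (hε : 0 < ε) : ∃ c ∈ groupAlgebraImage G, ‖c (deltaVec 1) - ξ‖ < ε := by
  classical
  have h := lp.hasSum_single (by norm_num) ξ
  obtain ⟨s, hs⟩ := (Metric.tendsto_nhds.1 h ε hε).exists
  refine ⟨∑ g ∈ s, ξ g • leftRegular G g, sum_mem fun g _ =>
    (groupAlgebraImage G).smul_mem (leftRegular_mem_groupAlgebraImage g) _, ?_⟩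
  have hsum : (∑ g ∈ s, ξ g • leftRegular G g) (deltaVec 1) = ∑ g ∈ s, lp.single 2 g (ξ g) := by
    rw [sum_apply]
    refine Finset.sum_congr rfl fun g _ => ?_
    rw [smul_apply, leftRegular_deltaVec_one, deltaVec, ← lp.single_smul, smul_eq_mul, mul_one]
  rw [hsum, ← dist_eq_norm]
  exact hs

/-- An operator bounded by `C` on the vectors `c δ_e` with `c` in the group algebra has norm at
most `C`. -/
theorem opNorm_le_of_groupAlgebraImage {G : Type u} [Group G] (b : GroupL2 G →L[ℂ] GroupL2 G)
    {C : ℝ} (hC : 0 ≤ C)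
    (h : ∀ c ∈ groupAlgebraImage G, ‖b (c (deltaVec 1))‖ ≤ C * ‖c (deltaVec 1)‖) : ‖b‖ ≤ C := by
  refine b.opNorm_le_bound hC fun ξ => ?_
  have hcl : ξ ∈ closure {η : GroupL2 G | ∃ c ∈ groupAlgebraImage G, c (deltaVec 1) = η} := by
    rw [Metric.mem_closure_iff]
    intro ε hε
    obtain ⟨c, hc, hcξ⟩ := exists_groupAlgebraImage_apply_near ξ hε
    exact ⟨_, ⟨c, hc, rfl⟩, by rwa [dist_comm, dist_eq_norm]⟩
  have hclosed : IsClosed {η : GroupL2 G | ‖b η‖ ≤ C * ‖η‖} :=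
    isClosed_le (by fun_prop) (by fun_prop)
  refine closure_minimal ?_ hclosed hcl
  rintro _ ⟨c, hc, rfl⟩
  exact h c hc

/-! ### Right translations and the trace property -/

/-- The unitary `δ_h ↦ δ_{hg⁻¹}` of right translation. -/
noncomputable def rightTranslation {G : Type u} [Group G] (g : G) : GroupL2 G →ₗᵢ[ℂ] GroupL2 G where
  toFun ξ := ⟨fun h => ξ (h * g), by
    refine memℓp_gen ?_
    exact ((Equiv.mulRight g).summable_iff).2 ((lp.memℓp ξ).summable (by norm_num))⟩
  map_add' ξ η := by ext h; rfl
  map_smul' c ξ := by ext h; rfl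
  norm_map' ξ := by
    refine (Real.rpow_left_inj (norm_nonneg _) (norm_nonneg _)
      (z := (2 : ENNReal).toReal) (by norm_num)).1 ?_
    rw [lp.norm_rpow_eq_tsum (by norm_num), lp.norm_rpow_eq_tsum (by norm_num)]
    exact (Equiv.mulRight g).tsum_eq (fun h => ‖ξ h‖ ^ (2 : ENNReal).toReal)

theorem rightTranslation_apply {G : Type u} [Group G] (g h : G) (ξ : GroupL2 G) :
    rightTranslation g ξ h = ξ (h * g) := rfl

theorem rightTranslation_deltaVec {G : Type u} [Group G] (g : G) :
    rightTranslation g (deltaVec g) = deltaVec 1 := by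
  classical
  ext k
  rw [rightTranslation_apply]
  simp only [deltaVec, lp.single_apply, Pi.single_apply]
  simp

/-- Elements of `L(G)` commute with right translations. -/
theorem groupVNA_apply_rightTranslation {G : Type u} [Group G] {a : GroupL2 G →L[ℂ] GroupL2 G}
    (ha : a ∈ groupVNA G) (g : G) (ξ : GroupL2 G) :
    a (rightTranslation g ξ) = rightTranslation g (a ξ) := by
  have h1 : a ∈ sotClosure (groupAlgebraImage G : Set (GroupL2 G →L[ℂ] GroupL2 G)) := ha
  rw [sotClosure_eq_bicommutant] at h1
  have h2 : (rightTranslation g).toContinuousLinearMap ∈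
      Set.centralizer (groupAlgebraImage G : Set (GroupL2 G →L[ℂ] GroupL2 G)) := by
    rw [Set.mem_centralizer_iff]
    rintro _ ⟨x, rfl⟩
    change MonoidAlgebra.lift ℂ (GroupL2 G →L[ℂ] GroupL2 G) G (leftRegular G) x * _ =
      _ * MonoidAlgebra.lift ℂ (GroupL2 G →L[ℂ] GroupL2 G) G (leftRegular G) x
    induction x using MonoidAlgebra.induction_on with
    | of k =>
      ext ξ h
      rw [MonoidAlgebra.lift_of]
      change ξ (k⁻¹ * h * g) = ξ (k⁻¹ * (h * g))
      rw [mul_assoc]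
    | add x y hx hy => rw [map_add, add_mul, mul_add, hx, hy]
    | smul c x hx => rw [map_smul, smul_mul_assoc, mul_smul_comm, hx]
  have h3 := Set.mem_centralizer_iff.1 h1 _ h2
  exact (DFunLike.congr_fun h3 ξ).symm

/-- The left side is the conjugate of the coefficient of `a δ_g` at the identity, and `a δ_g` is a
right translate of `a δ_e` because `a` commutes with right translations. -/
theorem star_apply_deltaVec_one {G : Type u} [Group G] {a : GroupL2 G →L[ℂ] GroupL2 G}
    (ha : a ∈ groupVNA G) (g : G) :
    (star a (deltaVec 1) : G → ℂ) g = star ((a (deltaVec 1) : G → ℂ) g⁻¹) := by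
  rw [← inner_deltaVec_left, ContinuousLinearMap.star_eq_adjoint,
    ContinuousLinearMap.adjoint_inner_right, ← inner_conj_symm, inner_deltaVec_left,
    ← rightTranslation_deltaVec g, groupVNA_apply_rightTranslation ha, rightTranslation_apply]
  simp

/-- The canonical functional on `L(G)` is a trace. -/
theorem groupTrace_mul_comm {G : Type u} [Group G] {a b : GroupL2 G →L[ℂ] GroupL2 G}
    (ha : a ∈ groupVNA G) (hb : b ∈ groupVNA G) : groupTrace G (a * b) = groupTrace G (b * a) := by
  -- The trace of a product is a convolution evaluated at the identity; the substitution `g ↦ g⁻¹`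
  -- exchanges the factors.
  have key : ∀ {a b : GroupL2 G →L[ℂ] GroupL2 G}, a ∈ groupVNA G →
      groupTrace G (a * b) = ∑' g, (a (deltaVec 1) : G → ℂ) g⁻¹ * (b (deltaVec 1) : G → ℂ) g := by
    intro a b ha
    rw [groupTrace, mul_apply_eq_comp, ← ContinuousLinearMap.adjoint_inner_left,
      ← ContinuousLinearMap.star_eq_adjoint, lp.inner_eq_tsum]
    refine tsum_congr fun g => ?_
    rw [star_apply_deltaVec_one ha]
    simp [mul_comm]
  rw [key ha, key hb, ← (Equiv.inv G).tsum_eq]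
  refine tsum_congr fun g => ?_
  simp [mul_comm]

theorem norm_star_apply_deltaVec_one {G : Type u} [Group G] {a : GroupL2 G →L[ℂ] GroupL2 G}
    (ha : a ∈ groupVNA G) : ‖star a (deltaVec 1)‖ = ‖a (deltaVec 1)‖ := by
  rw [← traceNorm_groupTrace, ← traceNorm_groupTrace, TracialLogic.traceNorm,
    TracialLogic.traceNorm, star_star, groupTrace_mul_comm ha (star_mem ha)]

/-- The adjoint preserves the `2`-norm by traciality and turns the right factor into a left one,
which the operator norm controls. This makes multiplication Lipschitz in its first factor. -/
theorem norm_mul_apply_deltaVec_one_le {G : Type u} [Group G] {a b : GroupL2 G →L[ℂ] GroupL2 G}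
    (ha : a ∈ groupVNA G) (hb : b ∈ groupVNA G) :
    ‖(a * b) (deltaVec 1)‖ ≤ ‖b‖ * ‖a (deltaVec 1)‖ := by
  rw [← norm_star_apply_deltaVec_one (mul_mem ha hb), star_mul, ← norm_star_apply_deltaVec_one ha,
    ← norm_star b]
  exact (star b).le_opNorm _

/-! ### Truncation and Kaplansky density -/

/-- Truncation of an element `y` of a closed `*`-subalgebra to norm `1`: with `m(t) = max 1 √t`, the
functions `Q = √(m - 1)` and `W = 1 / m` of `y* y` satisfy `‖y W‖ ≤ 1`, and the remainder
`y - y W` factors as `r Q` with `r = y Q W` and `r* r = Q²`. -/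
theorem exists_truncation {A : Type*} [CStarAlgebra A] (S : StarSubalgebra ℂ A)
    (hS : IsClosed (S : Set A)) {y : A} (hy : y ∈ S) :
    ∃ Q ∈ S, ∃ W ∈ S, IsSelfAdjoint Q ∧ IsSelfAdjoint W ∧ 1 - W = Q * W * Q ∧
      star (y * Q * W) * (y * Q * W) = Q * Q ∧ Q * star (y * Q * W) * (y * W) = Q * Q ∧
      ‖y * W‖ ≤ 1 := by
  let _ : PartialOrder A := CStarAlgebra.spectralOrder A
  have _ : StarOrderedRing A := CStarAlgebra.spectralOrderedRing A
  have hbsa : IsSelfAdjoint (star y * y) := IsSelfAdjoint.star_mul_self y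
  have hb0 : ∀ t ∈ spectrum ℝ (star y * y), 0 ≤ t := fun t ht =>
    spectrum_nonneg_of_nonneg (star_mul_self_nonneg y) ht
  have hbS : star y * y ∈ S := mul_mem (star_mem hy) hy
  set b := star y * y
  let m : ℝ → ℝ := fun t => max 1 (√t)
  have hm1 : ∀ t, 1 ≤ m t := fun t => le_max_left _ _
  have hm0 : ∀ t, m t ≠ 0 := fun t => (zero_lt_one.trans_le (hm1 t)).ne'
  have hmc : Continuous m := by fun_prop
  let q : ℝ → ℝ := fun t => √(m t - 1)
  let w : ℝ → ℝ := fun t => (m t)⁻¹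
  have hqc : Continuous q := by fun_prop
  have hwc : Continuous w := hmc.inv₀ hm0
  have hqq : ∀ t, q t * q t = m t - 1 := fun t => Real.mul_self_sqrt (by linarith [hm1 t])
  -- Either `m t = 1` or `(m t)² = t`. This identity yields both formulas that produce `Q * Q`.
  have hkey : ∀ t, 0 ≤ t → (m t - 1) * t = (m t - 1) * (m t * m t) := by
    intro t ht
    rcases le_total 1 (√t) with h | h
    · have : m t = √t := max_eq_right h
      rw [this, Real.mul_self_sqrt ht]
    · have : m t = 1 := max_eq_left h
      rw [this]; ring
  have hmt : ∀ t, 0 ≤ t → t ≤ m t * m t := fun t ht => by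
    calc t = √t * √t := (Real.mul_self_sqrt ht).symm
      _ ≤ m t * m t := mul_self_le_mul_self (Real.sqrt_nonneg t) (le_max_right _ _)
  have hQ : IsSelfAdjoint (cfc q b) := cfc_predicate q b
  have hW : IsSelfAdjoint (cfc w b) := cfc_predicate w b
  have hidb : cfc (id : ℝ → ℝ) b = b := cfc_id ℝ b
  have : IsClosed (S : Set A) := hS
  have hr : star (y * cfc q b * cfc w b) = cfc w b * cfc q b * star y := by
    rw [star_mul, star_mul, hQ.star_eq, hW.star_eq, mul_assoc]
  have hcont : ∀ f : ℝ → ℝ, Continuous f → ContinuousOn f (spectrum ℝ b) :=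
    fun f hf => hf.continuousOn
  have hmul : ∀ f g : ℝ → ℝ, Continuous f → Continuous g →
      cfc f b * cfc g b = cfc (f * g) b :=
    fun f g hf hg => (cfc_mul f g b (hcont f hf) (hcont g hg)).symm
  refine ⟨cfc q b, cfc_mem (𝕜' := ℂ) q hbS, cfc w b, cfc_mem (𝕜' := ℂ) w hbS, hQ, hW, ?_, ?_, ?_, ?_⟩
  · rw [← cfc_one ℝ b, ← cfc_sub _ _ b (hcont _ continuous_one) (hcont _ hwc),
      hmul q w hqc hwc,
      hmul (q * w) q (hqc.mul hwc) hqc]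
    refine cfc_congr fun t _ => ?_
    have h2 : q t * w t * q t = q t * q t * w t := by ring
    simp only [Pi.one_apply, Pi.mul_apply, h2, hqq, w]
    field_simp [hm0 t]
  · have : star (y * cfc q b * cfc w b) * (y * cfc q b * cfc w b) =
        cfc w b * cfc q b * cfc (id : ℝ → ℝ) b * cfc q b * cfc w b := by
      rw [hr, hidb]
      simp only [b, mul_assoc]
    rw [this, hmul w q hwc hqc, hmul _ id (hwc.mul hqc) continuous_id,
      hmul _ q ((hwc.mul hqc).mul continuous_id) hqc,
      hmul _ w (((hwc.mul hqc).mul continuous_id).mul hqc) hwc, hmul q q hqc hqc]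
    refine cfc_congr fun t ht => ?_
    have h1 := hkey t (hb0 t ht)
    have h2 : w t * q t * id t * q t * w t = (q t * q t) * t * (w t * w t) := by
      simp only [id]; ring
    simp only [Pi.mul_apply, h2, hqq, h1, w]
    field_simp [hm0 t]
  · have : cfc q b * star (y * cfc q b * cfc w b) * (y * cfc w b) =
        cfc q b * cfc w b * cfc q b * cfc (id : ℝ → ℝ) b * cfc w b := by
      rw [hr, hidb]
      simp only [b, mul_assoc]
    rw [this, hmul q w hqc hwc, hmul _ q (hqc.mul hwc) hqc,
      hmul _ id ((hqc.mul hwc).mul hqc) continuous_id,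
      hmul _ w (((hqc.mul hwc).mul hqc).mul continuous_id) hwc, hmul q q hqc hqc]
    refine cfc_congr fun t ht => ?_
    have h1 := hkey t (hb0 t ht)
    have h2 : q t * w t * q t * id t * w t = (q t * q t) * t * (w t * w t) := by
      simp only [id]; ring
    simp only [Pi.mul_apply, h2, hqq, h1, w]
    field_simp [hm0 t]
  · have h1 : star (y * cfc w b) * (y * cfc w b) = cfc (w * id * w) b := by
      rw [← hmul (w * id) w (hwc.mul continuous_id) hwc, ← hmul w id hwc continuous_id, hidb, star_mul,
        hW.star_eq]
      simp only [b, mul_assoc]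
    have h2 : ‖y * cfc w b‖ * ‖y * cfc w b‖ ≤ 1 := by
      rw [← CStarRing.norm_star_mul_self, h1]
      refine norm_cfc_le zero_le_one fun t ht => ?_
      have h0 := hb0 t ht
      have h3 : w t * id t * w t = t / (m t * m t) := by
        simp only [id, w]; field_simp [hm0 t]
      have hmm : 0 < m t * m t := mul_self_pos.2 (hm0 t)
      rw [Pi.mul_apply, Pi.mul_apply, h3, Real.norm_of_nonneg (div_nonneg h0 hmm.le), div_le_one hmm]
      exact hmt t h0
    nlinarith [norm_nonneg (y * cfc w b)]

theorem isClosed_groupVNA {G : Type u} [Group G] :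
    IsClosed (groupVNA G : Set (GroupL2 G →L[ℂ] GroupL2 G)) := by
  have h : (groupVNA G : Set (GroupL2 G →L[ℂ] GroupL2 G)) =
      sotClosure (groupAlgebraImage G : Set (GroupL2 G →L[ℂ] GroupL2 G)) := rfl
  rw [h, sotClosure_eq_bicommutant]
  exact Set.isClosed_centralizer _

/-- The continuous functional calculus stays in the norm closure of the group algebra; this
inclusion makes the trace property available there. -/
theorem topologicalClosure_le_groupVNA {G : Type u} [Group G]
    {a : GroupL2 G →L[ℂ] GroupL2 G} (ha : a ∈ (groupAlgebraImage G).topologicalClosure) :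
    a ∈ groupVNA G :=
  closure_minimal (fun _ hx => groupAlgebraImage_le_groupVNA hx) isClosed_groupVNA ha

theorem groupTrace_star_mul {G : Type u} [Group G] (a b : GroupL2 G →L[ℂ] GroupL2 G) :
    groupTrace G (star a * b) = inner ℂ (a (deltaVec 1)) (b (deltaVec 1)) := by
  rw [groupTrace, mul_apply_eq_comp, ContinuousLinearMap.star_eq_adjoint,
    ContinuousLinearMap.adjoint_inner_right]

/-- Elements of the norm closure of the group algebra can be truncated to norm at most `1` without
increasing the `2`-distance to elements of the unit ball of `L(G)`. -/
theorem exists_truncation_near {G : Type u} [Group G] {x y : GroupL2 G →L[ℂ] GroupL2 G}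
    (hx : x ∈ groupVNA G) (hx1 : ‖x‖ ≤ 1) (hy : y ∈ (groupAlgebraImage G).topologicalClosure) :
    ∃ a ∈ (groupAlgebraImage G).topologicalClosure, ‖a‖ ≤ 1 ∧
      ‖x (deltaVec 1) - a (deltaVec 1)‖ ≤ ‖x (deltaVec 1) - y (deltaVec 1)‖ := by
  obtain ⟨Q, hQ, W, hW, hQs, hWs, h1, h2, h3, h4⟩ := exists_truncation
    (groupAlgebraImage G).topologicalClosure
    (groupAlgebraImage G).isClosed_topologicalClosure hy
  refine ⟨y * W, mul_mem hy hW, h4, ?_⟩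
  set r := y * Q * W with hr
  have hrS : r ∈ (groupAlgebraImage G).topologicalClosure := mul_mem (mul_mem hy hQ) hW
  have hrQ : y - y * W = r * Q := by
    rw [← mul_one_sub, h1, hr]
    simp only [mul_assoc]
  have hsub : (y - y * W) (deltaVec 1) = y (deltaVec 1) - (y * W) (deltaVec 1) := rfl
  have hrnorm : ‖r (deltaVec 1)‖ = ‖Q (deltaVec 1)‖ := by
    rw [← traceNorm_groupTrace, ← traceNorm_groupTrace, TracialLogic.traceNorm,
      TracialLogic.traceNorm, h2, hQs.star_eq]
  -- Traciality moves `Q` next to `x`, so that Cauchy–Schwarz and `‖x‖ ≤ 1` bound the real part by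
  -- `‖Q δ_e‖²`, exactly the value attained when `x` is replaced by `y * W`.
  have hin : inner ℂ ((y - y * W) (deltaVec 1)) (x (deltaVec 1)) =
      inner ℂ (r (deltaVec 1)) ((x * Q) (deltaVec 1)) := by
    rw [← groupTrace_star_mul, ← groupTrace_star_mul, hrQ, star_mul, hQs.star_eq, mul_assoc,
      groupTrace_mul_comm (topologicalClosure_le_groupVNA hQ)
        (mul_mem (star_mem (topologicalClosure_le_groupVNA hrS)) hx), mul_assoc]
  have hle : (inner ℂ ((y - y * W) (deltaVec 1)) (x (deltaVec 1))).re ≤ ‖Q (deltaVec 1)‖ ^ 2 := by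
    rw [hin]
    calc _ ≤ ‖r (deltaVec 1)‖ * ‖(x * Q) (deltaVec 1)‖ := re_inner_le_norm (𝕜 := ℂ) _ _
      _ ≤ ‖Q (deltaVec 1)‖ * (1 * ‖Q (deltaVec 1)‖) := by
        rw [hrnorm]
        gcongr
        exact x.le_of_opNorm_le hx1 _
      _ = ‖Q (deltaVec 1)‖ ^ 2 := by ring
  have heq : (inner ℂ ((y - y * W) (deltaVec 1)) ((y * W) (deltaVec 1))).re =
      ‖Q (deltaVec 1)‖ ^ 2 := by
    have h5 : star (y - y * W) * (y * W) = star Q * Q := by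
      rw [hrQ, star_mul, hQs.star_eq, h3]
    rw [← groupTrace_star_mul, h5, groupTrace_star_mul]
    exact (norm_sq_eq_re_inner (𝕜 := ℂ) _).symm
  set ξ := x (deltaVec 1)
  set η := (y * W) (deltaVec 1)
  set ζ := y (deltaVec 1)
  rw [hsub] at hle heq
  -- The obtuse angle criterion for `η` to be the point nearest to `ζ` among the vectors of the unit
  -- ball; expanding `‖ξ - ζ‖²` then gives the claim.
  have hpos : 0 ≤ RCLike.re (inner ℂ (ξ - η) (η - ζ)) := by
    have h6 : inner ℂ (ξ - η) (η - ζ) = (starRingEnd ℂ) (inner ℂ (ζ - η) η - inner ℂ (ζ - η) ξ) := by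
      rw [← inner_sub_right, inner_conj_symm, ← neg_sub ξ η, ← neg_sub η ζ, inner_neg_left,
        inner_neg_right, neg_neg]
    rw [h6, RCLike.conj_re]
    change 0 ≤ (inner ℂ (ζ - η) η - inner ℂ (ζ - η) ξ).re
    rw [Complex.sub_re]
    linarith
  have h7 : ξ - ζ = (ξ - η) + (η - ζ) := by abel
  refine le_of_sq_le_sq ?_ (norm_nonneg _)
  rw [h7, norm_add_sq (𝕜 := ℂ)]
  nlinarith [sq_nonneg ‖η - ζ‖]

/-- The Kaplansky density theorem for `L(G)`, in the `2`-norm. -/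
theorem exists_groupAlgebraImage_near {G : Type u} [Group G] {x : GroupL2 G →L[ℂ] GroupL2 G}
    (hx : x ∈ groupVNA G) {n : ℕ} (hxn : ‖x‖ ≤ n) {ε : ℝ} (hε : 0 < ε) :
    ∃ a ∈ groupAlgebraImage G, ‖a‖ ≤ n ∧ ‖x (deltaVec 1) - a (deltaVec 1)‖ ≤ ε := by
  have unit : ∀ {x : GroupL2 G →L[ℂ] GroupL2 G}, x ∈ groupVNA G → ‖x‖ ≤ 1 → ∀ {ε : ℝ}, 0 < ε →
      ∃ a ∈ groupAlgebraImage G, ‖a‖ ≤ 1 ∧ ‖x (deltaVec 1) - a (deltaVec 1)‖ ≤ ε := by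
    intro x hx hx1 ε hε
    -- The three thirds of `ε` pay for the strong approximation `y` (with no norm control, then
    -- truncated to `a`), for returning from the norm closure to `c` in the group algebra, and for
    -- rescaling `c`, whose norm is at most `1 + ε / 3`.
    obtain ⟨y, hy, hyx⟩ := mem_sotClosure_iff.1 hx {deltaVec 1} (ε / 3) (by positivity)
    obtain ⟨a, ha, ha1, hxa⟩ := exists_truncation_near hx hx1
      ((groupAlgebraImage G).le_topologicalClosure hy)
    obtain ⟨c, hc, hca⟩ := Metric.mem_closure_iff.1 ha (ε / 3) (by positivity)
    rw [dist_eq_norm] at hca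
    have hyx' := hyx (deltaVec 1) (by simp)
    have hc1 : ‖c‖ ≤ 1 + ε / 3 := by
      have := norm_sub_norm_le c a
      rw [norm_sub_rev] at this
      linarith
    have hpos : (0 : ℝ) < 1 + ε / 3 := by positivity
    have hnn : ‖((1 + ε / 3 : ℝ) : ℂ)⁻¹‖ = (1 + ε / 3)⁻¹ := by
      rw [norm_inv, Complex.norm_of_nonneg hpos.le]
    refine ⟨((1 + ε / 3 : ℝ) : ℂ)⁻¹ • c, (groupAlgebraImage G).smul_mem hc _, ?_, ?_⟩
    · rw [norm_smul, hnn, inv_mul_le_iff₀ hpos, mul_one]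
      exact hc1
    · have h1 : ‖a (deltaVec 1) - c (deltaVec 1)‖ ≤ ε / 3 := by
        have := (a - c).le_opNorm (deltaVec 1)
        rw [norm_deltaVec, mul_one] at this
        exact this.trans hca.le
      have h2 : ‖c (deltaVec 1) - ((1 + ε / 3 : ℝ) : ℂ)⁻¹ • c (deltaVec 1)‖ ≤ ε / 3 := by
        have h3 : c (deltaVec 1) - ((1 + ε / 3 : ℝ) : ℂ)⁻¹ • c (deltaVec 1) =
            (((ε / 3 : ℝ) : ℂ) * ((1 + ε / 3 : ℝ) : ℂ)⁻¹) • c (deltaVec 1) := by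
          have h4 : ((1 + ε / 3 : ℝ) : ℂ) ≠ 0 := Complex.ofReal_ne_zero.2 hpos.ne'
          have h5 : ((ε / 3 : ℝ) : ℂ) * ((1 + ε / 3 : ℝ) : ℂ)⁻¹ =
              1 - ((1 + ε / 3 : ℝ) : ℂ)⁻¹ := by
            have h6 : ((ε / 3 : ℝ) : ℂ) = ((1 + ε / 3 : ℝ) : ℂ) - 1 := by
              push_cast
              ring
            rw [h6, sub_mul, one_mul, mul_inv_cancel₀ h4]
          rw [h5, sub_smul, one_smul]
        have h6 : ‖c (deltaVec 1)‖ ≤ 1 + ε / 3 := by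
          have := c.le_opNorm (deltaVec 1)
          rw [norm_deltaVec, mul_one] at this
          exact this.trans hc1
        rw [h3, norm_smul, norm_mul, hnn, Complex.norm_of_nonneg (by positivity), mul_assoc]
        refine mul_le_of_le_one_right (by positivity) ?_
        rwa [inv_mul_le_iff₀ hpos, mul_one]
      rw [smul_apply]
      have h7 : x (deltaVec 1) - ((1 + ε / 3 : ℝ) : ℂ)⁻¹ • c (deltaVec 1) =
          (x (deltaVec 1) - a (deltaVec 1)) + (a (deltaVec 1) - c (deltaVec 1)) +
            (c (deltaVec 1) - ((1 + ε / 3 : ℝ) : ℂ)⁻¹ • c (deltaVec 1)) := by abel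
      rw [norm_sub_rev] at hyx'
      rw [h7]
      refine (norm_add₃_le).trans ?_
      linarith
  rcases Nat.eq_zero_or_pos n with rfl | hn
  · have hx0 : x = 0 := norm_le_zero_iff.1 (by simpa using hxn)
    exact ⟨0, zero_mem _, by simp, by simp [hx0, hε.le]⟩
  · have hn' : (0 : ℝ) < n := by exact_mod_cast hn
    have hnn : ‖(n : ℂ)‖ = n := by simp
    have hn0 : (n : ℂ) ≠ 0 := by exact_mod_cast hn.ne'
    obtain ⟨a, ha, ha1, hxa⟩ := unit (x := (n : ℂ)⁻¹ • x)
      ((groupVNA G).toStarSubalgebra.smul_mem hx _)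
      (by rw [norm_smul, norm_inv, hnn, inv_mul_le_iff₀ hn', mul_one]; exact hxn)
      (ε := ε / n) (by positivity)
    refine ⟨(n : ℂ) • a, (groupAlgebraImage G).smul_mem ha _, ?_, ?_⟩
    · rw [norm_smul, hnn]
      exact mul_le_of_le_one_right hn'.le ha1
    · have h1 : x (deltaVec 1) - ((n : ℂ) • a) (deltaVec 1) =
          (n : ℂ) • (((n : ℂ)⁻¹ • x) (deltaVec 1) - a (deltaVec 1)) := by
        rw [smul_apply, smul_apply, smul_sub, smul_inv_smul₀ hn0]
      rw [h1, norm_smul, hnn, ← le_div_iff₀' hn']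
      exact hxa

/-! ### Matching elements of the two group algebras -/

section PairRel

variable {G : Type u} {H : Type v} [Group G] [Group H] {P P' : Type} [Group P] [Group P']

/-- Two operators on `ℓ²(G)` and `ℓ²(H)` are related by two homomorphisms `P → G` and `P → H` if
they are the images of one element of `ℂ[P]`. -/
inductive PairRel (f : P →* G) (f' : P →* H) :
    (GroupL2 G →L[ℂ] GroupL2 G) → (GroupL2 H →L[ℂ] GroupL2 H) → Prop
  | of (p : P) : PairRel f f' (leftRegular G (f p)) (leftRegular H (f' p))
  | add {a b a' b'} (h : PairRel f f' a b) (h' : PairRel f f' a' b') :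
      PairRel f f' (a + a') (b + b')
  | smul (c : ℂ) {a b} (h : PairRel f f' a b) : PairRel f f' (c • a) (c • b)

theorem PairRel.zero (f : P →* G) (f' : P →* H) : PairRel f f' 0 0 := by
  simpa only [zero_smul] using (PairRel.of (f := f) (f' := f') 1).smul 0

theorem PairRel.one (f : P →* G) (f' : P →* H) : PairRel f f' 1 1 := by
  simpa only [map_one] using PairRel.of (f := f) (f' := f') 1

theorem PairRel.mul {f : P →* G} {f' : P →* H} {a a' : GroupL2 G →L[ℂ] GroupL2 G}
    {b b' : GroupL2 H →L[ℂ] GroupL2 H} (h : PairRel f f' a b) (h' : PairRel f f' a' b') :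
    PairRel f f' (a * a') (b * b') := by
  induction h with
  | of p =>
    induction h' with
    | of q =>
      rw [← map_mul, ← map_mul, ← map_mul, ← map_mul]
      exact .of _
    | add _ _ ih ih' =>
      rw [mul_add, mul_add]
      exact ih.add ih'
    | smul c _ ih =>
      rw [mul_smul_comm, mul_smul_comm]
      exact ih.smul c
  | add _ _ ih ih' =>
    rw [add_mul, add_mul]
    exact ih.add ih'
  | smul c _ ih =>
    rw [smul_mul_assoc, smul_mul_assoc]
    exact ih.smul c

theorem PairRel.fst_mem {f : P →* G} {f' : P →* H} {a : GroupL2 G →L[ℂ] GroupL2 G}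
    {b : GroupL2 H →L[ℂ] GroupL2 H} (h : PairRel f f' a b) : a ∈ groupAlgebraImage G := by
  induction h with
  | of p => exact leftRegular_mem_groupAlgebraImage _
  | add _ _ ih ih' => exact add_mem ih ih'
  | smul c _ ih => exact (groupAlgebraImage G).smul_mem ih c

theorem PairRel.adj {f : P →* G} {f' : P →* H} {a : GroupL2 G →L[ℂ] GroupL2 G}
    {b : GroupL2 H →L[ℂ] GroupL2 H} (h : PairRel f f' a b) : PairRel f f' (star a) (star b) := by
  induction h with
  | of p =>
    rw [star_leftRegular, star_leftRegular, ← map_inv, ← map_inv]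
    exact .of _
  | add _ _ ih ih' =>
    rw [star_add, star_add]
    exact ih.add ih'
  | smul c _ ih =>
    rw [star_smul, star_smul]
    exact ih.smul _

theorem PairRel.symm {f : P →* G} {f' : P →* H} {a : GroupL2 G →L[ℂ] GroupL2 G}
    {b : GroupL2 H →L[ℂ] GroupL2 H} (h : PairRel f f' a b) : PairRel f' f b a := by
  induction h with
  | of p => exact .of p
  | add _ _ ih ih' => exact ih.add ih'
  | smul c _ ih => exact ih.smul c

/-- Matches made earlier in the game survive the enlargement of `P`. -/
theorem PairRel.of_comp {F : P' →* G} {F' : P' →* H} (i : P →* P') {a : GroupL2 G →L[ℂ] GroupL2 G}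
    {b : GroupL2 H →L[ℂ] GroupL2 H} (h : PairRel (F.comp i) (F'.comp i) a b) :
    PairRel F F' a b := by
  induction h with
  | of p => exact .of (i p)
  | add _ _ ih ih' => exact ih.add ih'
  | smul c _ ih => exact ih.smul c

/-- The trace of `u_g` only records whether `g = 1`, which injective homomorphisms preserve and
reflect; linearity does the rest. -/
theorem PairRel.groupTrace_eq {f : P →* G} {f' : P →* H}
    (hf : Function.Injective f) (hf' : Function.Injective f')
    {a : GroupL2 G →L[ℂ] GroupL2 G} {b : GroupL2 H →L[ℂ] GroupL2 H}
    (h : PairRel f f' a b) : groupTrace G a = groupTrace H b := by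
  classical
  induction h with
  | of p => simp only [groupTrace_leftRegular, map_eq_one_iff f hf, map_eq_one_iff f' hf']
  | add _ _ ih ih' =>
    simp only [groupTrace, add_apply, inner_add_right] at *
    rw [ih, ih']
  | smul c _ ih =>
    simp only [groupTrace, smul_apply, inner_smul_right] at *
    rw [ih]

theorem PairRel.traceNorm_eq {f : P →* G} {f' : P →* H}
    (hf : Function.Injective f) (hf' : Function.Injective f')
    {a : GroupL2 G →L[ℂ] GroupL2 G} {b : GroupL2 H →L[ℂ] GroupL2 H} (h : PairRel f f' a b) :
    TracialLogic.traceNorm (groupTrace G) a = TracialLogic.traceNorm (groupTrace H) b := by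
  rw [TracialLogic.traceNorm, TracialLogic.traceNorm, (h.adj.mul h).groupTrace_eq hf hf']

/-- An element of the group algebra has finite support; once `F` covers it, the element lifts to
`ℂ[P]` and can be pushed to `H`. -/
theorem exists_finset_pairRel (H : Type v) [Group H] {a : GroupL2 G →L[ℂ] GroupL2 G}
    (ha : a ∈ groupAlgebraImage G) :
    ∃ S : Finset G, ∀ (P : Type) [Group P] (F : P →* G) (F' : P →* H),
      (∀ s ∈ S, s ∈ F.range) → ∃ b, PairRel F F' a b := by
  classical
  obtain ⟨x, rfl⟩ := ha
  change ∃ S : Finset G, ∀ (P : Type) [Group P] (F : P →* G) (F' : P →* H),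
    (∀ s ∈ S, s ∈ F.range) →
      ∃ b, PairRel F F' (MonoidAlgebra.lift ℂ (GroupL2 G →L[ℂ] GroupL2 G) G (leftRegular G) x) b
  induction x using MonoidAlgebra.induction_on with
  | of g =>
    refine ⟨{g}, fun P _ F F' h => ?_⟩
    obtain ⟨p, rfl⟩ := h g (by simp)
    rw [MonoidAlgebra.lift_of]
    exact ⟨_, .of p⟩
  | add x y hx hy =>
    obtain ⟨S, hS⟩ := hx
    obtain ⟨T, hT⟩ := hy
    refine ⟨S ∪ T, fun P _ F F' h => ?_⟩
    obtain ⟨b, hb⟩ := hS P F F' fun s hs => h s (Finset.mem_union_left _ hs)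
    obtain ⟨c, hc⟩ := hT P F F' fun s hs => h s (Finset.mem_union_right _ hs)
    rw [map_add]
    exact ⟨b + c, hb.add hc⟩
  | smul c x hx =>
    obtain ⟨S, hS⟩ := hx
    refine ⟨S, fun P _ F F' h => ?_⟩
    obtain ⟨b, hb⟩ := hS P F F' h
    rw [map_smul]
    exact ⟨c • b, hb.smul c⟩

/-- The back-and-forth property for elements of the group algebra. -/
theorem IsOmegaExistentiallySaturated.exists_pairRel (hH : IsOmegaExistentiallySaturated H)
    [Group.FG P] {f : P →* G} (hf : Function.Injective f) {f' : P →* H}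
    (hf' : Function.Injective f') {a : GroupL2 G →L[ℂ] GroupL2 G} (ha : a ∈ groupAlgebraImage G) :
    ∃ (P' : Type) (_ : Group P') (_ : Group.FG P') (F : P' →* G) (F' : P' →* H)
      (b : GroupL2 H →L[ℂ] GroupL2 H),
      Function.Injective F ∧ Function.Injective F' ∧
        (∀ c d, PairRel f f' c d → PairRel F F' c d) ∧ PairRel F F' a b := by
  obtain ⟨S, hS⟩ := exists_finset_pairRel H ha
  obtain ⟨P', instP', hP', i, F, F', hF, hF', hi, hi', hSF⟩ := hH.back_and_forth f hf f' hf' S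
  obtain ⟨b, hb⟩ := hS P' F F' hSF
  refine ⟨P', instP', hP', F, F', b, hF, hF', fun c d hcd => ?_, hb⟩
  subst hi hi'
  exact hcd.of_comp i

/-- Related elements of the two group algebras have the same norm. -/
theorem IsOmegaExistentiallySaturated.norm_le_of_pairRel
    (hG : IsOmegaExistentiallySaturated G) [Group.FG P] {f : P →* G} (hf : Function.Injective f)
    {f' : P →* H} (hf' : Function.Injective f') {a : GroupL2 G →L[ℂ] GroupL2 G}
    {b : GroupL2 H →L[ℂ] GroupL2 H} (h : PairRel f f' a b) : ‖b‖ ≤ ‖a‖ := by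
  refine opNorm_le_of_groupAlgebraImage b (norm_nonneg a) fun c hc => ?_
  -- Saturation of `G` matches the test element `c` with some `d` over `G`; then `‖b c δ_e‖ = ‖a d
  -- δ_e‖` and `‖c δ_e‖ = ‖d δ_e‖`.
  obtain ⟨P', _, _, F', F, d, hF', hF, hle, hcd⟩ := hG.exists_pairRel hf' hf hc
  have hab : PairRel F F' a b := (hle _ _ h.symm).symm
  have h1 := (hab.mul hcd.symm).traceNorm_eq hF hF'
  have h2 := hcd.symm.traceNorm_eq hF hF'
  simp only [traceNorm_groupTrace, mul_apply_eq_comp] at h1 h2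
  rw [← h1, ← h2]
  exact a.le_opNorm _

end PairRel

/-! ### Comparison of suprema and infima -/

/-- The index types differ because the quantifiers range over balls of different algebras. The
bounds `B`, `C` keep the real suprema from taking their default value. -/
theorem abs_ciSup_sub_ciSup_le {ι κ : Type*} [Nonempty ι] [Nonempty κ] {f : ι → ℝ} {g : κ → ℝ}
    {B C ε : ℝ} (hf : ∀ i, |f i| ≤ B) (hg : ∀ j, |g j| ≤ C)
    (h : ∀ i, ∃ j, |f i - g j| ≤ ε) (h' : ∀ j, ∃ i, |f i - g j| ≤ ε) :
    |(⨆ i, f i) - ⨆ j, g j| ≤ ε := by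
  have bf : BddAbove (Set.range f) := ⟨B, by rintro _ ⟨i, rfl⟩; exact (abs_le.1 (hf i)).2⟩
  have bg : BddAbove (Set.range g) := ⟨C, by rintro _ ⟨i, rfl⟩; exact (abs_le.1 (hg i)).2⟩
  have h1 : (⨆ i, f i) ≤ (⨆ j, g j) + ε := ciSup_le fun i => by
    obtain ⟨j, hj⟩ := h i
    linarith [(abs_le.1 hj).2, le_ciSup bg j]
  have h2 : (⨆ j, g j) ≤ (⨆ i, f i) + ε := ciSup_le fun j => by
    obtain ⟨i, hi⟩ := h' j
    linarith [(abs_le.1 hi).1, le_ciSup bf i]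
  exact abs_le.2 ⟨by linarith, by linarith⟩

theorem abs_ciInf_sub_ciInf_le {ι κ : Type*} [Nonempty ι] [Nonempty κ] {f : ι → ℝ} {g : κ → ℝ}
    {B C ε : ℝ} (hf : ∀ i, |f i| ≤ B) (hg : ∀ j, |g j| ≤ C)
    (h : ∀ i, ∃ j, |f i - g j| ≤ ε) (h' : ∀ j, ∃ i, |f i - g j| ≤ ε) :
    |(⨅ i, f i) - ⨅ j, g j| ≤ ε := by
  have bf : BddBelow (Set.range f) := ⟨-B, by rintro _ ⟨i, rfl⟩; exact (abs_le.1 (hf i)).1⟩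
  have bg : BddBelow (Set.range g) := ⟨-C, by rintro _ ⟨i, rfl⟩; exact (abs_le.1 (hg i)).1⟩
  have h1 : (⨅ j, g j) - ε ≤ ⨅ i, f i := le_ciInf fun i => by
    obtain ⟨j, hj⟩ := h i
    linarith [(abs_le.1 hj).1, ciInf_le bg j]
  have h2 : (⨅ i, f i) - ε ≤ ⨅ j, g j := le_ciInf fun j => by
    obtain ⟨i, hi⟩ := h' j
    linarith [(abs_le.1 hi).2, ciInf_le bf i]
  exact abs_le.2 ⟨by linarith, by linarith⟩

theorem abs_ciSup_le {ι : Type*} [Nonempty ι] {f : ι → ℝ} {B : ℝ} (hf : ∀ i, |f i| ≤ B) :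
    |⨆ i, f i| ≤ B := by
  simpa using abs_ciSup_sub_ciSup_le (κ := Unit) (g := fun _ => 0) (C := 0) (ε := B) hf (by simp)
    (fun i => ⟨(), by simpa using hf i⟩)
    (fun _ => ⟨Classical.arbitrary ι, by simpa using hf (Classical.arbitrary ι)⟩)

theorem abs_ciInf_le {ι : Type*} [Nonempty ι] {f : ι → ℝ} {B : ℝ} (hf : ∀ i, |f i| ≤ B) :
    |⨅ i, f i| ≤ B := by
  simpa using abs_ciInf_sub_ciInf_le (κ := Unit) (g := fun _ => 0) (C := 0) (ε := B) hf (by simp)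
    (fun i => ⟨(), by simpa using hf i⟩)
    (fun _ => ⟨Classical.arbitrary ι, by simpa using hf (Classical.arbitrary ι)⟩)

namespace TracialLogic

instance {E : Type*} [NormedAddCommGroup E] [InnerProductSpace ℂ E] [CompleteSpace E]
    (M : VonNeumannAlgebra E) (n : ℕ) : Nonempty (Ball M n) :=
  ⟨⟨0, zero_mem M, by simp⟩⟩

/-! ### Uniform continuity of terms and formulas in the `2`-norm -/

section UniformContinuity

variable {G : Type u} [Group G]

/-- The assignments `v` and `w` are within `d` of each other in the `2`-norm. -/
def Assignment.Near {Γ : List ℕ} (v w : Assignment (groupVNA G) Γ) (d : ℝ) : Prop :=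
  ∀ n x, ‖((v n x).1 - (w n x).1) (deltaVec 1)‖ ≤ d

theorem Assignment.Near.cons {Γ : List ℕ} {v w : Assignment (groupVNA G) Γ} {d : ℝ}
    (h : v.Near w d) {n : ℕ} {a b : Ball (groupVNA G) n}
    (hab : ‖(a.1 - b.1) (deltaVec 1)‖ ≤ d) :
    (Assignment.cons a v).Near (Assignment.cons b w) d := by
  intro m x
  cases x with
  | here => exact hab
  | there x => exact h m x

theorem norm_apply_deltaVec_one_le {n : ℕ} (a : Ball (groupVNA G) n) :
    ‖a.1 (deltaVec 1)‖ ≤ n := by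
  have := a.1.le_of_opNorm_le a.2.2 (deltaVec 1)
  rwa [norm_deltaVec, mul_one] at this

theorem abs_re_groupTrace_le (x : GroupL2 G →L[ℂ] GroupL2 G) :
    |(groupTrace G x).re| ≤ ‖x (deltaVec 1)‖ := by
  refine (Complex.abs_re_le_norm _).trans ((norm_inner_le_norm _ _).trans ?_)
  rw [norm_deltaVec, one_mul]

theorem abs_im_groupTrace_le (x : GroupL2 G →L[ℂ] GroupL2 G) :
    |(groupTrace G x).im| ≤ ‖x (deltaVec 1)‖ := by
  refine (Complex.abs_im_le_norm _).trans ((norm_inner_le_norm _ _).trans ?_)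
  rw [norm_deltaVec, one_mul]

theorem groupTrace_sub (x y : GroupL2 G →L[ℂ] GroupL2 G) :
    groupTrace G (x - y) = groupTrace G x - groupTrace G y := by
  rw [groupTrace, sub_apply, inner_sub_right]
  rfl

/-- Terms are Lipschitz in the `2`-norm. -/
theorem Term.exists_lipschitz {Γ : List ℕ} {n : ℕ} (t : Term Γ n) :
    ∃ C : ℝ, 0 ≤ C ∧ ∀ (v w : Assignment (groupVNA G) Γ) (d : ℝ), 0 ≤ d → v.Near w d →
      ‖((t.eval v).1 - (t.eval w).1) (deltaVec 1)‖ ≤ C * d := by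
  induction t with
  | var x => exact ⟨1, zero_le_one, fun v w d _ h => by rw [one_mul]; exact h _ x⟩
  | zero =>
    refine ⟨0, le_rfl, fun v w d hd h => ?_⟩
    change ‖((0 : GroupL2 G →L[ℂ] GroupL2 G) - 0) (deltaVec 1)‖ ≤ 0 * d
    simp
  | one =>
    refine ⟨0, le_rfl, fun v w d hd h => ?_⟩
    change ‖((1 : GroupL2 G →L[ℂ] GroupL2 G) - 1) (deltaVec 1)‖ ≤ 0 * d
    simp
  | incl h t ih => exact ih
  | add s t ihs iht =>
    obtain ⟨C, hC, hs⟩ := ihs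
    obtain ⟨D, hD, ht⟩ := iht
    refine ⟨C + D, add_nonneg hC hD, fun v w d hd h => ?_⟩
    change ‖((s.eval v).1 + (t.eval v).1 - ((s.eval w).1 + (t.eval w).1)) (deltaVec 1)‖ ≤ _
    rw [add_sub_add_comm, add_apply, add_mul]
    exact (norm_add_le _ _).trans (add_le_add (hs v w d hd h) (ht v w d hd h))
  | @mul m n s t ihs iht =>
    obtain ⟨C, hC, hs⟩ := ihs
    obtain ⟨D, hD, ht⟩ := iht
    refine ⟨m * D + n * C, by positivity, fun v w d hd h => ?_⟩
    change ‖((s.eval v).1 * (t.eval v).1 - (s.eval w).1 * (t.eval w).1) (deltaVec 1)‖ ≤ _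
    -- The first summand only needs the operator norm of its left factor; the second needs the trace
    -- property. The radii `m` and `n` of the sorts enter as Lipschitz constants.
    have h1 : (s.eval v).1 * (t.eval v).1 - (s.eval w).1 * (t.eval w).1 =
        (s.eval v).1 * ((t.eval v).1 - (t.eval w).1) +
          ((s.eval v).1 - (s.eval w).1) * (t.eval w).1 := by
      rw [mul_sub, sub_mul]
      abel
    have h2 : ‖((s.eval v).1 * ((t.eval v).1 - (t.eval w).1)) (deltaVec 1)‖ ≤ m * (D * d) :=
      ((s.eval v).1.le_of_opNorm_le (s.eval v).2.2 _).trans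
        (mul_le_mul_of_nonneg_left (ht v w d hd h) (Nat.cast_nonneg _))
    have h3 : ‖(((s.eval v).1 - (s.eval w).1) * (t.eval w).1) (deltaVec 1)‖ ≤ n * (C * d) :=
      (norm_mul_apply_deltaVec_one_le (sub_mem (s.eval v).2.1 (s.eval w).2.1)
        (t.eval w).2.1).trans
        (mul_le_mul (t.eval w).2.2 (hs v w d hd h) (norm_nonneg _) (Nat.cast_nonneg _))
    rw [h1, add_apply]
    refine (norm_add_le _ _).trans ((add_le_add h2 h3).trans_eq ?_)
    ring
  | smul c t ih =>
    obtain ⟨C, hC, ht⟩ := ih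
    refine ⟨‖c‖ * C, by positivity, fun v w d hd h => ?_⟩
    change ‖(c • (t.eval v).1 - c • (t.eval w).1) (deltaVec 1)‖ ≤ _
    rw [← smul_sub, smul_apply, norm_smul, mul_assoc]
    exact mul_le_mul_of_nonneg_left (ht v w d hd h) (norm_nonneg _)
  | adj t ih =>
    obtain ⟨C, hC, ht⟩ := ih
    refine ⟨C, hC, fun v w d hd h => ?_⟩
    change ‖(star (t.eval v).1 - star (t.eval w).1) (deltaVec 1)‖ ≤ _
    rw [← star_sub, norm_star_apply_deltaVec_one (sub_mem (t.eval v).2.1 (t.eval w).2.1)]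
    exact ht v w d hd h

/-- A Lipschitz function of the assignment is uniformly continuous. -/
theorem exists_modulus_of_lipschitz {Γ : List ℕ} {F : Assignment (groupVNA G) Γ → ℝ} {C : ℝ}
    (hC : 0 ≤ C) (h : ∀ v w d, 0 ≤ d → Assignment.Near v w d → |F v - F w| ≤ C * d) {ε : ℝ}
    (hε : 0 < ε) : ∃ d > 0, ∀ v w, Assignment.Near v w d → |F v - F w| ≤ ε := by
  refine ⟨ε / (C + 1), by positivity, fun v w hvw => (h v w _ (by positivity) hvw).trans ?_⟩
  rw [← mul_div_assoc, div_le_iff₀ (by positivity)]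
  nlinarith

/-- Formulas are bounded and uniformly continuous in the `2`-norm. -/
theorem Formula.bounded_and_uniformContinuous {Γ : List ℕ} (φ : Formula Γ) :
    (∃ B : ℝ, ∀ v, |φ.eval (groupVNA G) (groupTrace G) v| ≤ B) ∧
      ∀ ε > 0, ∃ d > 0, ∀ v w, Assignment.Near v w d →
        |φ.eval (groupVNA G) (groupTrace G) v - φ.eval (groupVNA G) (groupTrace G) w| ≤ ε := by
  induction φ with
  | @dist Γ n s t =>
    have hev : ∀ v, (Formula.dist s t).eval (groupVNA G) (groupTrace G) v =
        ‖(s.eval v).1 (deltaVec 1) - (t.eval v).1 (deltaVec 1)‖ := fun v =>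
      traceNorm_groupTrace _
    simp only [hev]
    obtain ⟨C, hC, hs⟩ := s.exists_lipschitz (G := G)
    obtain ⟨D, hD, ht⟩ := t.exists_lipschitz (G := G)
    refine ⟨⟨n + n, fun v => ?_⟩, fun ε hε =>
      exists_modulus_of_lipschitz (add_nonneg hC hD) (fun v w d hd h => ?_) hε⟩
    · rw [abs_norm]
      exact (norm_sub_le _ _).trans
        (add_le_add (norm_apply_deltaVec_one_le _) (norm_apply_deltaVec_one_le _))
    · refine (abs_norm_sub_norm_le _ _).trans ?_
      rw [sub_sub_sub_comm, add_mul]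
      exact (norm_sub_le _ _).trans (add_le_add (hs v w d hd h) (ht v w d hd h))
  | @reTr Γ n t =>
    obtain ⟨C, hC, ht⟩ := t.exists_lipschitz (G := G)
    refine ⟨⟨n, fun v => (abs_re_groupTrace_le _).trans (norm_apply_deltaVec_one_le _)⟩,
      fun ε hε => exists_modulus_of_lipschitz hC (fun v w d hd h => ?_) hε⟩
    change |(groupTrace G (t.eval v).1).re - (groupTrace G (t.eval w).1).re| ≤ _
    rw [← Complex.sub_re, ← groupTrace_sub]
    exact (abs_re_groupTrace_le _).trans (ht v w d hd h)
  | @imTr Γ n t =>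
    obtain ⟨C, hC, ht⟩ := t.exists_lipschitz (G := G)
    refine ⟨⟨n, fun v => (abs_im_groupTrace_le _).trans (norm_apply_deltaVec_one_le _)⟩,
      fun ε hε => exists_modulus_of_lipschitz hC (fun v w d hd h => ?_) hε⟩
    change |(groupTrace G (t.eval v).1).im - (groupTrace G (t.eval w).1).im| ≤ _
    rw [← Complex.sub_im, ← groupTrace_sub]
    exact (abs_im_groupTrace_le _).trans (ht v w d hd h)
  | @conn Γ k f φ ih =>
    choose B hB using fun i => (ih i).1
    -- The subformulas take values in a compact box, on which the connective is bounded and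
    -- uniformly continuous.
    have hK : IsCompact (Set.univ.pi fun i => Set.Icc (-B i) (B i)) :=
      isCompact_univ_pi fun i => isCompact_Icc
    have hmem : ∀ v : Assignment (groupVNA G) Γ,
        (fun i => (φ i).eval (groupVNA G) (groupTrace G) v) ∈
          Set.univ.pi fun i => Set.Icc (-B i) (B i) :=
      fun v i _ => abs_le.1 (hB i v)
    refine ⟨?_, fun ε hε => ?_⟩
    · obtain ⟨C, hC⟩ := hK.exists_bound_of_continuousOn f.continuous.continuousOn
      exact ⟨C, fun v => hC _ (hmem v)⟩
    · obtain ⟨η, hη, hf⟩ := Metric.uniformContinuousOn_iff_le.1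
        (hK.uniformContinuousOn_of_continuous f.continuous.continuousOn) ε hε
      choose d hd hφ using fun i => (ih i).2 η hη
      -- A lower bound taken inside `Set.Ioi 0` is automatically positive, and exists even for `k =
      -- 0`.
      obtain ⟨⟨δ, hδ⟩, hle⟩ := (Set.finite_range
        (fun i => (⟨d i, hd i⟩ : Set.Ioi (0 : ℝ)))).bddBelow
      refine ⟨δ, hδ, fun v w h => hf _ (hmem v) _ (hmem w) ?_⟩
      rw [dist_pi_le_iff hη.le]
      exact fun i => hφ i v w fun m x => (h m x).trans (hle ⟨i, rfl⟩)
  | @sup Γ n φ ih =>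
    obtain ⟨⟨B, hB⟩, hφ⟩ := ih
    refine ⟨⟨B, fun v => abs_ciSup_le fun a => hB _⟩, fun ε hε => ?_⟩
    obtain ⟨d, hd, h⟩ := hφ ε hε
    have key : ∀ v w, Assignment.Near v w d → ∀ a : Ball (groupVNA G) n,
        |φ.eval (groupVNA G) (groupTrace G) (Assignment.cons a v) -
          φ.eval (groupVNA G) (groupTrace G) (Assignment.cons a w)| ≤ ε :=
      fun v w hvw a => h _ _ (hvw.cons (by simpa using hd.le))
    exact ⟨d, hd, fun v w hvw => abs_ciSup_sub_ciSup_le (fun _ => hB _) (fun _ => hB _)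
      (fun a => ⟨a, key v w hvw a⟩) fun a => ⟨a, key v w hvw a⟩⟩
  | @inf Γ n φ ih =>
    obtain ⟨⟨B, hB⟩, hφ⟩ := ih
    refine ⟨⟨B, fun v => abs_ciInf_le fun a => hB _⟩, fun ε hε => ?_⟩
    obtain ⟨d, hd, h⟩ := hφ ε hε
    have key : ∀ v w, Assignment.Near v w d → ∀ a : Ball (groupVNA G) n,
        |φ.eval (groupVNA G) (groupTrace G) (Assignment.cons a v) -
          φ.eval (groupVNA G) (groupTrace G) (Assignment.cons a w)| ≤ ε :=
      fun v w hvw a => h _ _ (hvw.cons (by simpa using hd.le))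
    exact ⟨d, hd, fun v w hvw => abs_ciInf_sub_ciInf_le (fun _ => hB _) (fun _ => hB _)
      (fun a => ⟨a, key v w hvw a⟩) fun a => ⟨a, key v w hvw a⟩⟩

end UniformContinuity

/-! ### Transfer of values of formulas -/

section BackAndForth

variable {G : Type u} {H : Type v} [Group G] [Group H]

/-- Assignments in `L(G)` and `L(H)` with related values. -/
def Assignment.Related {P : Type} [Group P] (f : P →* G) (f' : P →* H) {Γ : List ℕ}
    (v : Assignment (groupVNA G) Γ) (w : Assignment (groupVNA H) Γ) : Prop :=
  ∀ n x, PairRel f f' (v n x).1 (w n x).1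

theorem Assignment.Related.symm {P : Type} [Group P] {f : P →* G} {f' : P →* H} {Γ : List ℕ}
    {v : Assignment (groupVNA G) Γ} {w : Assignment (groupVNA H) Γ} (h : v.Related f f' w) :
    w.Related f' f v :=
  fun n x => (h n x).symm

theorem Assignment.Related.cons {P : Type} [Group P] {f : P →* G} {f' : P →* H} {Γ : List ℕ}
    {v : Assignment (groupVNA G) Γ} {w : Assignment (groupVNA H) Γ} (h : v.Related f f' w) {n : ℕ}
    {a : Ball (groupVNA G) n} {b : Ball (groupVNA H) n} (hab : PairRel f f' a.1 b.1) :
    (Assignment.cons a v).Related f f' (Assignment.cons b w) := by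
  intro m x
  cases x with
  | here => exact hab
  | there x => exact h m x

theorem Term.pairRel_eval {P : Type} [Group P] {f : P →* G} {f' : P →* H} {Γ : List ℕ}
    {v : Assignment (groupVNA G) Γ} {w : Assignment (groupVNA H) Γ} (h : v.Related f f' w)
    {n : ℕ} (t : Term Γ n) : PairRel f f' (t.eval v).1 (t.eval w).1 := by
  induction t with
  | var x => exact h _ x
  | zero => exact .zero f f'
  | one => exact .one f f'
  | incl _ _ ih => exact ih
  | add _ _ ihs iht => exact ihs.add iht
  | mul _ _ ihs iht => exact ihs.mul iht
  | smul c _ ih => exact ih.smul c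
  | adj _ ih => exact ih.adj

/-- The formula `φ` has the same value at related assignments. -/
def Formula.Transfers (G : Type u) (H : Type v) [Group G] [Group H] {Γ : List ℕ}
    (φ : Formula Γ) : Prop :=
  ∀ (P : Type) [Group P] [Group.FG P] (f : P →* G) (f' : P →* H), Function.Injective f →
    Function.Injective f' → ∀ v w, Assignment.Related f f' v w →
      φ.eval (groupVNA G) (groupTrace G) v = φ.eval (groupVNA H) (groupTrace H) w

theorem Formula.Transfers.symm {Γ : List ℕ} {φ : Formula Γ} (h : φ.Transfers G H) :
    φ.Transfers H G :=
  fun P _ _ f f' hf hf' v w hvw => (h P f' f hf' hf w v hvw.symm).symm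

/-- A move in the back-and-forth game between `L(G)` and `L(H)`. -/
theorem Formula.Transfers.exists_ball_near {n : ℕ} {Γ : List ℕ} {φ : Formula (n :: Γ)}
    (hφ : φ.Transfers G H) (hG : IsOmegaExistentiallySaturated G)
    (hH : IsOmegaExistentiallySaturated H) {P : Type} [Group P] [Group.FG P] {f : P →* G}
    {f' : P →* H} (hf : Function.Injective f) (hf' : Function.Injective f')
    {v : Assignment (groupVNA G) Γ} {w : Assignment (groupVNA H) Γ} (hvw : v.Related f f' w)
    (a : Ball (groupVNA G) n) {ε : ℝ} (hε : 0 < ε) :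
    ∃ b : Ball (groupVNA H) n, |φ.eval (groupVNA G) (groupTrace G) (Assignment.cons a v) -
      φ.eval (groupVNA H) (groupTrace H) (Assignment.cons b w)| ≤ ε := by
  obtain ⟨d, hd, hnear⟩ := (φ.bounded_and_uniformContinuous (G := G)).2 ε hε
  -- Only the replacement of `a` by `c` costs `ε`. The answer to `c` is exact, and saturation of `G`
  -- keeps it in the ball of radius `n`.
  obtain ⟨c, hc, hcn, hac⟩ := exists_groupAlgebraImage_near a.2.1 a.2.2 hd
  obtain ⟨P', _, _, F, F', b, hF, hF', hle, hcb⟩ := hH.exists_pairRel hf hf' hc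
  let c' : Ball (groupVNA G) n := ⟨c, groupAlgebraImage_le_groupVNA hc, hcn⟩
  let b' : Ball (groupVNA H) n := ⟨b, groupAlgebraImage_le_groupVNA hcb.symm.fst_mem,
    (hG.norm_le_of_pairRel hF hF' hcb).trans hcn⟩
  have hvw' : v.Related F F' w := fun m x => hle _ _ (hvw m x)
  refine ⟨b', ?_⟩
  rw [← hφ P' F F' hF hF' _ _ (hvw'.cons (a := c') (b := b') hcb)]
  refine hnear _ _ (Assignment.Near.cons (fun m x => ?_) hac)
  simpa using hd.le

theorem Formula.transfers (hG : IsOmegaExistentiallySaturated G)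
    (hH : IsOmegaExistentiallySaturated H) {Γ : List ℕ} (φ : Formula Γ) : φ.Transfers G H := by
  induction φ with
  | dist s t =>
    intro P _ _ f f' hf hf' v w hvw
    have h : PairRel f f' ((s.eval v).1 - (t.eval v).1) ((s.eval w).1 - (t.eval w).1) := by
      have h := (s.pairRel_eval hvw).add ((t.pairRel_eval hvw).smul (-1))
      rwa [neg_one_smul, neg_one_smul, ← sub_eq_add_neg, ← sub_eq_add_neg] at h
    exact h.traceNorm_eq hf hf'
  | reTr t =>
    intro P _ _ f f' hf hf' v w hvw
    exact congrArg Complex.re ((t.pairRel_eval hvw).groupTrace_eq hf hf')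
  | imTr t =>
    intro P _ _ f f' hf hf' v w hvw
    exact congrArg Complex.im ((t.pairRel_eval hvw).groupTrace_eq hf hf')
  | conn g φ ih =>
    intro P _ _ f f' hf hf' v w hvw
    exact congrArg g (funext fun i => ih i P f f' hf hf' v w hvw)
  | sup n φ ih =>
    intro P _ _ f f' hf hf' v w hvw
    obtain ⟨B, hB⟩ := (φ.bounded_and_uniformContinuous (G := G)).1
    obtain ⟨C, hC⟩ := (φ.bounded_and_uniformContinuous (G := H)).1
    -- Moves can only be answered up to `ε`, but this for every `ε`, which forces the suprema to be
    -- equal.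
    refine eq_of_forall_dist_le fun ε hε => ?_
    refine abs_ciSup_sub_ciSup_le (fun _ => hB _) (fun _ => hC _)
      (fun a => ih.exists_ball_near hG hH hf hf' hvw a hε) fun b => ?_
    obtain ⟨a, ha⟩ := ih.symm.exists_ball_near hH hG hf' hf hvw.symm b hε
    exact ⟨a, by rwa [abs_sub_comm]⟩
  | inf n φ ih =>
    intro P _ _ f f' hf hf' v w hvw
    obtain ⟨B, hB⟩ := (φ.bounded_and_uniformContinuous (G := G)).1
    obtain ⟨C, hC⟩ := (φ.bounded_and_uniformContinuous (G := H)).1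
    refine eq_of_forall_dist_le fun ε hε => ?_
    refine abs_ciInf_sub_ciInf_le (fun _ => hB _) (fun _ => hC _)
      (fun a => ih.exists_ball_near hG hH hf hf' hvw a hε) fun b => ?_
    obtain ⟨a, ha⟩ := ih.symm.exists_ball_near hH hG hf' hf hvw.symm b hε
    exact ⟨a, by rwa [abs_sub_comm]⟩

end BackAndForth

end TracialLogic

theorem mainTheorem11 {G : Type u} {H : Type v} [Group G] [Group H]
    (hG : IsOmegaExistentiallySaturated G) (hH : IsOmegaExistentiallySaturated H) :
    TracialLogic.ElementarilyEquivalent (groupVNA G) (groupTrace G) (groupVNA H) (groupTrace H) :=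
  -- The game starts from the trivial group, which embeds in both groups, with no variables to
  -- match.
  fun σ => σ.transfers hG hH Unit 1 1 (Function.injective_of_subsingleton _)
    (Function.injective_of_subsingleton _) _ _ fun _ x => nomatch x
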